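/- **Notation.** For an integer $n$, $I_n$ is the modified Bessel function of the first kind ($I_{-n}=I_n$). For $a,b\in\mathbb R$ and integers $M,N\ge 0$ the Nuttall $Q$-function is $Q_{M,N}(a,b)=\int_b^\infty x^M e^{-(x^2+a^2)/2}I_N(ax)\,dx$; for $M\in\mathbb Z$ and $a\neq 0$ (or $M=1$ and $a=0$, with $a^{1-M}=1$) the generalized Marcum $Q$-function is $Q_M(a,b)=a^{1-M}\int_b^\infty x^M e^{-(x^2+a^2)/2}I_{M-1}(ax)\,dx$ (with $b\ge 0$ if $M\le 0$). The regularized confluent hypergeometric function of two variables is $$\tilde\Phi_3(b,c;w,z)=\sum_{p,q\ge 0}\frac{(b)_p}{\Gamma(c+p+q)}\frac{w^p z^q}{p!\,q!},$$ with $1/\Gamma=0$ at the poles of $\Gamma$ and $(x)_p=x(x+1)\cdots(x+p-1)$. For $\alpha>0$, $\beta,\gamma\in\mathbb R$, $u\ge 0$ and integers $k,c\ge 0$, $j\ge 1$, $m,n\ge 1$ let $$\mathcal J^{\alpha,\beta,\gamma}_{k,c,j}(u)=\int_u^\infty z^{2j+k-1}e^{-\alpha z^2}Q_{2c+k+1,k}(\gamma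 z,\beta)\,dz,\qquad \mathcal K^{\alpha,\beta,\gamma}_{m,n}(u)=\int_u^\infty z^{2n-1}e^{-\alpha z^2}Q_m(\gamma z,\beta)\,dz,$$ $\delta=\alpha+\gamma^2/2$, $\theta=\gamma^2/(\gamma^2+2\alpha)$, and $$\omega_{l,k}(c)=2^{c-l+1}\frac{c!}{(l-1)!}\binom{c+k}{c-l+1},\qquad P_{c,l,k}(\beta^2)=\sum_{r=0}^{c-l}2^{c-l-r}\frac{(c-1-r)!}{(l-1)!}\binom{c+k}{c-l-r}\beta^{2r}.$$ **Theorem.** The integral $\mathcal J^{\alpha,\beta,\gamma}_{k,c,j}(u)$ converges and is a finite combination of Marcum $Q$-functions and modified Bessel functions, given explicitly by (1)–(4). (1) For $\alpha>0$, $\beta,\gamma\in\mathbb R$, $u\ge 0$, $$\mathcal J^{\alpha,\beta,\gamma}_{k,c,j}(u)=e^{-\frac{\beta^2}{2}\left\{1-\frac{\gamma^2}{2\delta}\right\}}\sum_{l=1}^{c}P_{c,l,k}(\beta^2)\frac{\gamma^{l-1}\beta^{k+l+1}}{\sqrt{2\delta}^{\,2j+(k+l-1)}}\,Q_{2(j-1)+(k+l-1)+1,\,k+l-1}\Big(\tfrac{\gamma\beta}{\sqrt{2\delta}},u\sqrt{2\delta}\Big)+\sum_{l=1}^{c+1}\omega_{l,k}(c)\,\gamma^{k+2(l-1)}\,\mathcal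 K^{\alpha,\beta,\gamma}_{k+l,\,j+k+l-1}(u),$$ where, for $\gamma=0$, the $\mathcal K$-terms whose coefficient contains a positive power of $\gamma$ are zero. (2) For $\alpha>0$, $\beta\ne0$, $\gamma\neq 0$, $u\ge 0$, the integral $\mathcal K^{\alpha,\beta,\gamma}_{m,n}(u)$ converges and $$\mathcal K^{\alpha,\beta,\gamma}_{m,n}(u)=\frac{\delta^{-n}}{2}(n-1)!\,e^{-\beta^2/2}e^{-u^2\delta}\sum_{k=0}^{n-1}\frac{(\delta u^2)^k}{k!}\,\mathcal I^{\beta,\delta,\theta}_{m,n,k}(u),$$ $$\begin{aligned}\mathcal I^{\beta,\delta,\theta}_{m,n,k}(u)&=(1-\theta)^{k-n}e^{\beta^2/2}e^{\delta\theta u^2}-(1-\theta)^{k-n}\Big(\tfrac{\beta^2}{2}\Big)^{k+m-n}\tilde\Phi_3\Big(1,k+m-n+1;\tfrac{\beta^2}{2},\tfrac{\delta\theta u^2\beta^2}{2}\Big)\\&\quad+\sum_{l=1}^{n-k}(1-\theta)^{k+l-n-1}\Big(\tfrac{\beta^2}{2}\Big)^{k+m-n+l-1}\tilde\Phi_3\Big(l,k+m-n+l;\theta\tfrac{\beta^2}{2},\tfrac{\delta\theta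 u^2\beta^2}{2}\Big).\end{aligned}$$ (3) For integers $b\ge1$ and $c$, and for $w>0$, $z>0$ (also for $z=0$ if $b=1$), $$\tilde\Phi_3(b,c;w,z)=\Big(\frac zw\Big)^{b-1}\sum_{i=0}^{2(b-1)}\frac{\mathcal A_i(b,c;z)}{w^{c-i-1}z^i}\,e^{w+z/w}\,Q_{2-c+i}\big(\sqrt{2w},\sqrt{2z/w}\big),$$ $$\mathcal A_i(b,c;z)=\frac{(-1)^{b-1}}{(b-1)!}\sum_{k=0}^{\lfloor i/2\rfloor}\frac{(-1)^k(b-i+k)_{i-k}(c-i-1+k)_{i-2k}}{(i-2k)!\,k!}z^k.$$ (4) For integers $c,k\ge0$ and $a\neq 0$, $b\in\mathbb R$, $$Q_{2c+k+1,k}(a,b)=\sum_{l=1}^{c+1}\omega_{l,k}(c)\,a^{k+2(l-1)}Q_{k+l}(a,b)+e^{-\frac{a^2+b^2}{2}}\sum_{l=1}^{c}P_{c,l,k}(b^2)\,a^{l-1}b^{k+l+1}I_{k+l-1}(ab);$$ for $a=0$ this holds as well, terms with a positive power of $a$ being zero. Consequently, for $\alpha>0$, $\beta\neq0$, $\gamma\ne0$,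 $u>0$, substituting (2), (3), (4) into (1) expresses $\mathcal J^{\alpha,\beta,\gamma}_{k,c,j}(u)$ through finitely many Marcum $Q$-functions and modified Bessel functions. For all $\beta,\gamma\in\mathbb R$ and $u\ge0$ this expression, evaluated at $(\beta',\gamma',u')$ with $\beta'\ne0$, $\gamma'\neq0$, $u'>0$, tends to $\mathcal J^{\alpha,\beta,\gamma}_{k,c,j}(u)$ as $(\beta',\gamma',u')\to(\beta,\gamma,u)$, so that for $\beta=0$, $\gamma=0$ or $u=0$ it holds in the limit. -/

import Mathlib

open MeasureTheory Filter Topology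

noncomputable section

/-- Modified Bessel function of the first kind `I_n` of integer order, with the usual convention
`I_{-n} = I_n`. -/
def besselI (n : ℤ) (x : ℝ) : ℝ :=
  ∑' r : ℕ, (x / 2) ^ (2 * r + n.natAbs) / ((r.factorial : ℝ) * ((r + n.natAbs).factorial : ℝ))

/-- Nuttall Q-function `Q_{M,N}(a,b) = ∫_b^∞ x^M exp(-(x²+a²)/2) I_N(a x) dx`. -/
def nuttallQ (M N : ℕ) (a b : ℝ) : ℝ :=
  ∫ x in Set.Ioi b, x ^ M * Real.exp (-(x ^ 2 + a ^ 2) / 2) * besselI N (a * x)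

/-- Generalized Marcum Q-function of integer order,
`Q_M(a,b) = a^{1-M} ∫_b^∞ x^M exp(-(x²+a²)/2) I_{M-1}(a x) dx`. -/
def marcumQ (M : ℤ) (a b : ℝ) : ℝ :=
  1 / a ^ (M - 1) *
    ∫ x in Set.Ioi b, x ^ M * Real.exp (-(x ^ 2 + a ^ 2) / 2) * besselI (M - 1) (a * x)

/-- Integrand of the incomplete integral of the Nuttall Q-function. -/
def iinqIntegrand (k c j : ℕ) (α β γ z : ℝ) : ℝ :=
  z ^ (2 * j + k - 1) * Real.exp (-α * z ^ 2) * nuttallQ (2 * c + k + 1) k (γ * z) β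

/-- Incomplete integral of the Nuttall Q-function, `J^{α,β,γ}_{k,c,j}(u)`. -/
def iinq (k c j : ℕ) (α β γ u : ℝ) : ℝ :=
  ∫ z in Set.Ioi u, iinqIntegrand k c j α β γ z

/-- Integrand of the incomplete integral of the Marcum Q-function. -/
def kIntegrand (m n : ℕ) (α β γ z : ℝ) : ℝ :=
  z ^ (2 * n - 1) * Real.exp (-α * z ^ 2) * marcumQ m (γ * z) β

/-- Incomplete integral of the Marcum Q-function, `K^{α,β,γ}_{m,n}(u)`. -/
def kIntegral (m n : ℕ) (α β γ u : ℝ) : ℝ :=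
  ∫ z in Set.Ioi u, kIntegrand m n α β γ z

/-- Regularized confluent hypergeometric function of two variables,
`Φ₃(b,c;w,z)/Γ(c) = ∑_{p,q} (b)_p w^p z^q / (Γ(c+p+q) p! q!)`.
Here `1/Γ` vanishes at the poles of `Γ`, in accordance with `Real.Gamma (-n) = 0` and `0⁻¹ = 0`. -/
def phi3Reg (b c w z : ℝ) : ℝ :=
  ∑' p : ℕ × ℕ, (ascPochhammer ℝ p.1).eval b * (Real.Gamma (c + p.1 + p.2))⁻¹ *
    w ^ p.1 * z ^ p.2 / ((p.1.factorial : ℝ) * (p.2.factorial : ℝ))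

/-- The auxiliary parameter `δ = α + γ²/2`. -/
def deltaPar (α γ : ℝ) : ℝ := α + γ ^ 2 / 2

/-- The auxiliary parameter `θ = γ²/(γ² + 2α)`. -/
def thetaPar (α γ : ℝ) : ℝ := γ ^ 2 / (γ ^ 2 + 2 * α)

/-- The coefficient `ω_{l,k}(c)`, for `1 ≤ l ≤ c + 1`. -/
def omegaCoeff (l k c : ℕ) : ℝ :=
  2 ^ (c + 1 - l) * ((c.factorial : ℝ) / ((l - 1).factorial : ℝ)) *
    ((c + k).choose (c + 1 - l) : ℝ)

/-- The coefficient `P_{c,l,k}(B)`, for `1 ≤ l ≤ c`; it is used at `B = β²`. -/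
def pCoeff (c l k : ℕ) (B : ℝ) : ℝ :=
  ∑ r ∈ Finset.range (c - l + 1),
    2 ^ (c - l - r) * (((c - 1 - r).factorial : ℝ) / ((l - 1).factorial : ℝ)) *
      ((c + k).choose (c - l - r) : ℝ) * B ^ r

/-- Finite expression in Marcum Q-functions and modified Bessel functions for
`Q_{2c+k+1,k}(a,b)`. -/
def nuttallClosed (c k : ℕ) (a b : ℝ) : ℝ :=
  (∑ l ∈ Finset.Icc 1 (c + 1),
      omegaCoeff l k c * a ^ (k + 2 * (l - 1)) * marcumQ ((k : ℤ) + l) a b) +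
    Real.exp (-(a ^ 2 + b ^ 2) / 2) *
      ∑ l ∈ Finset.Icc 1 c,
        pCoeff c l k (b ^ 2) * a ^ (l - 1) * b ^ (k + l + 1) *
          besselI ((k : ℤ) + l - 1) (a * b)

/-- The coefficient `A_i(b,c;z)`. -/
def aCoeff (i b : ℕ) (c : ℤ) (z : ℝ) : ℝ :=
  (-1) ^ (b - 1) / ((b - 1).factorial : ℝ) *
    ∑ k ∈ Finset.range (i / 2 + 1),
      (-1) ^ k * (ascPochhammer ℝ (i - k)).eval ((b : ℝ) - i + k) *
        (ascPochhammer ℝ (i - 2 * k)).eval ((c : ℝ) - i - 1 + k) /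
          (((i - 2 * k).factorial : ℝ) * (k.factorial : ℝ)) * z ^ k

/-- Finite expression in Marcum Q-functions for the regularized `Φ₃(b,c;w,z)`. -/
def phi3Closed (b : ℕ) (c : ℤ) (w z : ℝ) : ℝ :=
  (z / w) ^ (b - 1) *
    ∑ i ∈ Finset.range (2 * (b - 1) + 1),
      aCoeff i b c z / (w ^ (c - i - 1) * z ^ i) * Real.exp (w + z / w) *
        marcumQ (2 - c + i) (Real.sqrt (2 * w)) (Real.sqrt (2 * (z / w)))

/-- The expression for `I^{β,δ,θ}_{m,n,k}(u)`, in which the function `Φ` stands for the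
regularized `Φ₃`. -/
def iForm (Φ : ℕ → ℤ → ℝ → ℝ → ℝ) (m n k : ℕ) (β δ θ u : ℝ) : ℝ :=
  (1 - θ) ^ ((k : ℤ) - n) * Real.exp (β ^ 2 / 2) * Real.exp (δ * θ * u ^ 2) -
    (1 - θ) ^ ((k : ℤ) - n) * (β ^ 2 / 2) ^ ((k : ℤ) + m - n) *
      Φ 1 ((k : ℤ) + m - n + 1) (β ^ 2 / 2) (δ * θ * u ^ 2 * β ^ 2 / 2) +
    ∑ l ∈ Finset.Icc 1 (n - k),
      (1 - θ) ^ ((k : ℤ) + l - n - 1) * (β ^ 2 / 2) ^ ((k : ℤ) + m - n + l - 1) *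
        Φ l ((k : ℤ) + m - n + l) (θ * (β ^ 2 / 2)) (δ * θ * u ^ 2 * β ^ 2 / 2)

/-- The expression for `K^{α,β,γ}_{m,n}(u)`, in which the function `Φ` stands for the
regularized `Φ₃`. -/
def kForm (Φ : ℕ → ℤ → ℝ → ℝ → ℝ) (m n : ℕ) (α β γ u : ℝ) : ℝ :=
  ((deltaPar α γ) ^ n)⁻¹ / 2 * ((n - 1).factorial : ℝ) * Real.exp (-β ^ 2 / 2) *
    Real.exp (-u ^ 2 * deltaPar α γ) *
      ∑ k ∈ Finset.range n, (deltaPar α γ * u ^ 2) ^ k / (k.factorial : ℝ) *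
        iForm Φ m n k β (deltaPar α γ) (thetaPar α γ) u

/-- The expression for `J^{α,β,γ}_{k,c,j}(u)`, in which `Q c' k'` stands for the Nuttall function
`Q_{2c'+k'+1,k'}` and `K` for the incomplete integral of the Marcum Q-function. -/
def iinqForm (Q : ℕ → ℕ → ℝ → ℝ → ℝ) (K : ℕ → ℕ → ℝ → ℝ → ℝ → ℝ → ℝ)
    (k c j : ℕ) (α β γ u : ℝ) : ℝ :=
  Real.exp (-β ^ 2 / 2 * (1 - γ ^ 2 / (2 * deltaPar α γ))) *
      (∑ l ∈ Finset.Icc 1 c,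
        pCoeff c l k (β ^ 2) *
          (γ ^ (l - 1) * β ^ (k + l + 1) /
            Real.sqrt (2 * deltaPar α γ) ^ (2 * j + (k + l - 1))) *
          Q (j - 1) (k + l - 1) (γ * β / Real.sqrt (2 * deltaPar α γ))
            (u * Real.sqrt (2 * deltaPar α γ))) +
    ∑ l ∈ Finset.Icc 1 (c + 1),
      omegaCoeff l k c * γ ^ (k + 2 * (l - 1)) * K (k + l) (j + k + l - 1) α β γ u

/-- The resulting finite closed form of `J^{α,β,γ}_{k,c,j}(u)`, which involves no special functions
other than Marcum Q-functions and modified Bessel functions. -/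
def iinqClosed (k c j : ℕ) (α β γ u : ℝ) : ℝ :=
  iinqForm nuttallClosed (kForm phi3Closed) k c j α β γ u

end

/-!
With `y = b² / 2` and `w = a² / 2`, integrating the Bessel series termwise against the elementary
integrals `∫_u^∞ x^{2n+1} e^{-δx²} dx` (`hasSum_integral_odd_series`) turns every function of the
theorem into a power series whose coefficients are partial sums `E_n(y) = ∑_{0 ≤ i ≤ n} y^i / i!`.
In particular `Q_M(a,b) = e^{-w-y} ∑_s (w^s / s!) E_{s+M-1}(y)` for every integer `M`
(`marcumSeries`, `marcumQ_eq_marcumSeries`). Each identity then becomes one between coefficients.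

* Nuttall through Marcum: the coefficients of `Q_{2c+k+1,k}` contain
  `(r+c+k)! / (r+k)!`, which Vandermonde's convolution expands in falling factorials of `r`. The
  part `E_{r+k}` of `E_{r+c+k}` gives the Marcum functions, the remaining terms
  `y^{r+k+i} / (r+k+i)!` give the Bessel functions (`nuttallQ_eq_nuttallSeries`). Substituting this
  into the incomplete integral and scaling by `√(2δ)` in the Bessel terms reduces `J` to `K`
  (`iinq_eq_iinqForm`).

* `K` through `Φ₃`: termwise integration gives, up to elementary factors,
  `K_{m,n} = ∑_s C(n+s-1,s) θ^s E_{s+m-1}(y) E_{s+n-1}(δu²)`. By Vandermonde this is a combination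
  of the averages `∑_s C(J+s-1,s) θ^s E_{A+J+s}(y)` (`hasSum_sum_iForm`). Multiplication by `1 - θ`
  lowers `J` by one at the cost of a series that is a row of `Φ₃` (`one_sub_mul_negBinomPartial`);
  iterating down to `J = 0` produces `I_{m,n,k}` (`hasSum_iForm`).

* `Φ₃` through Marcum: for first parameter `1` the double series of `Φ₃` is the Marcum series summed
  in the other order (`marcumSeries_eq_phi3Reg`). The contiguous relation
  `b w Φ(b+1,c) = Φ(b,c-2) - (c-2) Φ(b,c-1) - z Φ(b,c)` lowers the first parameter, and the
  coefficients `A_i` satisfy the same recursion (`phi3Reg_eq_sum_falling`).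

For the limit, the closed form agrees with `J` wherever `β ≠ 0`, `γ ≠ 0` and `u > 0`, and `J` itself
is continuous in `(β, γ, u)` by dominated convergence: the series of the Marcum function lies in
`[0, 1]`, `|I_n(x)| ≤ e^{|x|}`, and so all integrands are dominated by some `|z|^N e^{-αz²}`
(`continuous_iinq`).
-/

noncomputable section

/-! ### Partial sums of the exponential series and Gaussian integrals -/

theorem HasSum.congr_term {ι : Type*} {f g : ι → ℝ} {S : ℝ} (h : HasSum f S)
    (hfg : ∀ i, g i = f i) : HasSum g S := by
  rwa [funext hfg]

/-- The term `y^n / n!` of the exponential series for an integer index `n`; it vanishes for `n < 0`,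
where `Real.Gamma (n + 1) = 0`. -/
def expTerm (n : ℤ) (y : ℝ) : ℝ := y ^ n * (Real.Gamma (n + 1))⁻¹

/-- The partial sum `∑_{0 ≤ i ≤ n} y^i / i!` of the exponential series for an integer `n`; it is
empty for `n < 0`. -/
def expPartial (n : ℤ) (y : ℝ) : ℝ := ∑ i ∈ Finset.range (n + 1).toNat, y ^ i / (i.factorial : ℝ)

theorem expTerm_natCast (n : ℕ) (y : ℝ) : expTerm n y = y ^ n / (n.factorial : ℝ) := by
  simp [expTerm, Real.Gamma_nat_eq_factorial, div_eq_mul_inv]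

theorem expTerm_of_neg {n : ℤ} (hn : n < 0) (y : ℝ) : expTerm n y = 0 := by
  obtain ⟨m, rfl⟩ : ∃ m : ℕ, n = -(m : ℤ) - 1 := ⟨(-n - 1).toNat, by omega⟩
  have h : Real.Gamma (((-(m : ℤ) - 1 : ℤ) : ℝ) + 1) = 0 := by
    rw [← Real.Gamma_neg_nat_eq_zero m]
    congr 1
    push_cast
    ring
  rw [expTerm, h, inv_zero, mul_zero]

theorem expPartial_natCast (n : ℕ) (y : ℝ) :
    expPartial n y = ∑ i ∈ Finset.range (n + 1), y ^ i / (i.factorial : ℝ) := by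
  rw [expPartial]
  congr 2

theorem expPartial_of_neg {n : ℤ} (hn : n < 0) (y : ℝ) : expPartial n y = 0 := by
  have : (n + 1).toNat = 0 := by omega
  simp [expPartial, this]

theorem expPartial_eq_add_expTerm (n : ℤ) (y : ℝ) :
    expPartial n y = expPartial (n - 1) y + expTerm n y := by
  rcases lt_or_ge n 0 with hn | hn
  · rw [expPartial_of_neg hn, expPartial_of_neg (by omega), expTerm_of_neg hn, add_zero]
  · lift n to ℕ using hn
    rw [expPartial_natCast, Finset.sum_range_succ, expTerm_natCast, expPartial]
    congr 3
    omega

theorem abs_expPartial_le (n : ℤ) (y : ℝ) : |expPartial n y| ≤ Real.exp |y| := by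
  refine (Finset.abs_sum_le_sum_abs _ _).trans ?_
  refine le_trans (le_of_eq ?_) (Real.sum_le_exp_of_nonneg (abs_nonneg y) (n + 1).toNat)
  exact Finset.sum_congr rfl fun i _ => by simp [abs_div, abs_pow]

theorem expPartial_nonneg (n : ℤ) {y : ℝ} (hy : 0 ≤ y) : 0 ≤ expPartial n y :=
  Finset.sum_nonneg fun _ _ => by positivity

theorem expPartial_le_exp (n : ℤ) {y : ℝ} (hy : 0 ≤ y) : expPartial n y ≤ Real.exp y := by
  have := abs_expPartial_le n y
  rw [abs_of_nonneg hy] at this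
  exact (le_abs_self _).trans this

theorem continuous_expPartial (n : ℤ) : Continuous (expPartial n) := by
  unfold expPartial
  fun_prop

theorem hasSum_exp (y : ℝ) : HasSum (fun i : ℕ => y ^ i / (i.factorial : ℝ)) (Real.exp y) := by
  rw [Real.exp_eq_exp_ℝ]
  exact NormedSpace.expSeries_div_hasSum_exp y

/-- The tail of the exponential series, starting at an arbitrary integer. -/
theorem hasSum_expTerm_tail (n : ℤ) (y : ℝ) :
    HasSum (fun p : ℕ => expTerm (n + p) y) (Real.exp y - expPartial (n - 1) y) := by
  have step : ∀ n : ℤ, HasSum (fun p : ℕ => expTerm (n + 1 + p) y)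
      (Real.exp y - expPartial (n + 1 - 1) y) ↔
      HasSum (fun p : ℕ => expTerm (n + p) y) (Real.exp y - expPartial (n - 1) y) := by
    intro n
    rw [← hasSum_nat_add_iff' (f := fun p : ℕ => expTerm (n + p) y) 1]
    have h1 : (fun p : ℕ => expTerm (n + 1 + p) y) =
        fun p : ℕ => expTerm (n + ((p + 1 : ℕ) : ℤ)) y := by
      funext p
      congr 1
      push_cast
      ring
    have h2 : Real.exp y - expPartial (n + 1 - 1) y =
        Real.exp y - expPartial (n - 1) y - ∑ i ∈ Finset.range 1, expTerm (n + i) y := by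
      rw [add_sub_cancel_right, expPartial_eq_add_expTerm n]
      simp
      ring
    rw [h1, h2]
  induction n using Int.induction_on with
  | zero =>
    have := hasSum_exp y
    simpa [expTerm_natCast, expPartial_of_neg] using this
  | succ i ih => exact (step _).2 ih
  | pred i ih =>
    refine (step _).1 ?_
    simpa using ih

theorem hasDerivAt_expPartial (n : ℕ) (y : ℝ) :
    HasDerivAt (expPartial n) (expPartial ((n : ℤ) - 1) y) y := by
  induction n with
  | zero =>
    have : expPartial ((0 : ℕ) : ℤ) = fun _ => (1 : ℝ) := by
      funext y
      simp [expPartial]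
    rw [this, expPartial_of_neg (by simp)]
    exact hasDerivAt_const y 1
  | succ n ih =>
    have : expPartial ((n + 1 : ℕ) : ℤ) =
        fun y => expPartial n y + y ^ (n + 1) / ((n + 1).factorial : ℝ) := by
      funext y
      rw [expPartial_natCast, Finset.sum_range_succ, expPartial_natCast]
    rw [this]
    refine (ih.add ((hasDerivAt_pow (n + 1) y).div_const _)).congr_deriv ?_
    rw [show (((n + 1 : ℕ) : ℤ) - 1) = (n : ℤ) by push_cast; ring, expPartial_eq_add_expTerm n,
      expTerm_natCast, Nat.factorial_succ]
    push_cast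
    field_simp

theorem integrable_pow_mul_gaussian {δ : ℝ} (hδ : 0 < δ) (n : ℕ) :
    Integrable (fun x : ℝ => x ^ n * Real.exp (-δ * x ^ 2)) := by
  have := integrable_rpow_mul_exp_neg_mul_sq hδ (s := n) (by
    have : (0 : ℝ) ≤ n := Nat.cast_nonneg n
    linarith)
  simpa using this

theorem tendsto_exp_neg_mul_expPartial (n : ℤ) :
    Tendsto (fun y => Real.exp (-y) * expPartial n y) atTop (𝓝 0) := by
  have h : ∀ i ∈ Finset.range (n + 1).toNat,
      Tendsto (fun y : ℝ => y ^ i * Real.exp (-y) / (i.factorial : ℝ)) atTop (𝓝 0) := fun i _ => by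
    simpa using (Real.tendsto_pow_mul_exp_neg_atTop_nhds_zero i).div_const (i.factorial : ℝ)
  have := tendsto_finsetSum _ h
  simp only [Finset.sum_const_zero] at this
  refine this.congr fun y => ?_
  rw [expPartial, Finset.mul_sum]
  exact Finset.sum_congr rfl fun i _ => by ring

/-- `∫_u^∞ x^{2n+1} e^{-δx²} dx`, an elementary integral, for every real `u`. -/
theorem integral_odd_pow_mul_gaussian {δ : ℝ} (hδ : 0 < δ) (n : ℕ) (u : ℝ) :
    ∫ x in Set.Ioi u, x ^ (2 * n + 1) * Real.exp (-δ * x ^ 2) =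
      (n.factorial : ℝ) / (2 * δ ^ (n + 1)) *
        (Real.exp (-(δ * u ^ 2)) * expPartial n (δ * u ^ 2)) := by
  have hderiv : ∀ x ∈ Set.Ici u, HasDerivAt
      (fun x => -((n.factorial : ℝ) / (2 * δ ^ (n + 1))) *
        (Real.exp (-(δ * x ^ 2)) * expPartial n (δ * x ^ 2)))
      (x ^ (2 * n + 1) * Real.exp (-δ * x ^ 2)) x := by
    intro x _
    have h1 : HasDerivAt (fun x : ℝ => δ * x ^ 2) (δ * (2 * x)) x := by
      simpa using (hasDerivAt_pow 2 x).const_mul δ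
    have h2 := (hasDerivAt_expPartial n (δ * x ^ 2)).comp x h1
    refine ((h1.neg.exp.mul h2).const_mul _).congr_deriv ?_
    simp only [Function.comp_apply, Pi.neg_apply]
    rw [expPartial_eq_add_expTerm n, expTerm_natCast, neg_mul]
    field_simp
    ring
  have hlim : Tendsto (fun x : ℝ => -((n.factorial : ℝ) / (2 * δ ^ (n + 1))) *
      (Real.exp (-(δ * x ^ 2)) * expPartial n (δ * x ^ 2))) atTop (𝓝 0) := by
    have h1 : Tendsto (fun x : ℝ => δ * x ^ 2) atTop atTop :=
      (tendsto_pow_atTop two_ne_zero).const_mul_atTop hδ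
    simpa using ((tendsto_exp_neg_mul_expPartial n).comp h1).const_mul
      (-((n.factorial : ℝ) / (2 * δ ^ (n + 1))))
  rw [integral_Ioi_of_hasDerivAt_of_tendsto' hderiv
    (integrable_pow_mul_gaussian hδ _).integrableOn hlim]
  ring

theorem integral_abs_odd_pow_mul_gaussian {δ : ℝ} (hδ : 0 < δ) (n : ℕ) :
    ∫ x : ℝ, |x ^ (2 * n + 1) * Real.exp (-δ * x ^ 2)| = (n.factorial : ℝ) / δ ^ (n + 1) := by
  have h := integral_comp_abs (f := fun x : ℝ => x ^ (2 * n + 1) * Real.exp (-δ * x ^ 2))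
  rw [integral_odd_pow_mul_gaussian hδ] at h
  have h0 : expPartial n (δ * 0 ^ 2) = 1 := by
    rw [expPartial_natCast, Finset.sum_eq_single 0] <;> simp +contextual
  rw [h0] at h
  simp only [abs_mul, abs_pow, Real.abs_exp]
  simp only [sq_abs] at h
  rw [h]
  simp
  field_simp

/-- Termwise integration of a series of odd powers against a Gaussian. -/
theorem hasSum_integral_odd_series {δ : ℝ} (hδ : 0 < δ) (n : ℕ) (c : ℕ → ℝ)
    (hc : Summable fun r => |c r| * (((r + n).factorial : ℝ) / δ ^ r)) (u : ℝ) :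
    HasSum (fun r => c r * (((r + n).factorial : ℝ) / (2 * δ ^ (r + n + 1)) *
        (Real.exp (-(δ * u ^ 2)) * expPartial ((r + n : ℕ) : ℤ) (δ * u ^ 2))))
      (∫ x in Set.Ioi u, ∑' r, c r * (x ^ (2 * (r + n) + 1) * Real.exp (-δ * x ^ 2))) := by
  have hint : ∀ r, Integrable (fun x : ℝ =>
      c r * (x ^ (2 * (r + n) + 1) * Real.exp (-δ * x ^ 2))) := fun r =>
    (integrable_pow_mul_gaussian hδ _).const_mul _
  have := hasSum_integral_of_summable_integral_norm (μ := volume.restrict (Set.Ioi u))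
    (fun r => (hint r).integrableOn) ?_
  · simpa only [integral_const_mul, integral_odd_pow_mul_gaussian hδ] using this
  · refine Summable.of_nonneg_of_le (fun r => integral_nonneg fun x => norm_nonneg _) (fun r => ?_)
      (hc.mul_right (1 / δ ^ (n + 1)))
    refine (setIntegral_le_integral (hint r).norm (ae_of_all _ fun x => norm_nonneg _)).trans ?_
    simp only [norm_mul (c r)]
    simp only [Real.norm_eq_abs]
    rw [integral_const_mul, integral_abs_odd_pow_mul_gaussian hδ]
    apply le_of_eq
    rw [show r + n + 1 = r + (n + 1) by ring, pow_add]
    field_simp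

/-! ### Continuity of exponentially dominated series -/

/-- A series of continuous functions dominated by an exponential series, with locally bounded
parameters, has a continuous sum. -/
theorem continuous_tsum_of_le_exp_series {X : Type*} [TopologicalSpace X] {F : ℕ → X → ℝ}
    (hF : ∀ r, Continuous (F r)) {B R : X → ℝ} (hB : Continuous B) (hR : Continuous R)
    (hR0 : ∀ x, 0 ≤ R x)
    (hle : ∀ r x, |F r x| ≤ B x * (R x ^ r / (r.factorial : ℝ))) :
    Continuous fun x => ∑' r, F r x := by
  rw [continuous_iff_continuousAt]
  intro x₀
  have hU : {x | B x < B x₀ + 1} ∩ {x | R x < R x₀ + 1} ∈ 𝓝 x₀ :=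
    inter_mem ((isOpen_lt hB continuous_const).mem_nhds (by simp))
      ((isOpen_lt hR continuous_const).mem_nhds (by simp))
  refine ContinuousOn.continuousAt (continuousOn_tsum (fun r => (hF r).continuousOn)
    ((hasSum_exp (R x₀ + 1)).summable.mul_left (B x₀ + 1)) ?_) hU
  rintro r x ⟨hx1, hx2⟩
  have h1 : B x ≤ B x₀ + 1 := le_of_lt hx1
  have h2 : R x ≤ R x₀ + 1 := le_of_lt hx2
  have h3 : 0 ≤ B x := by
    have := (abs_nonneg _).trans (hle 0 x)
    simpa using this
  refine (hle r x).trans ?_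
  have := hR0 x
  have h4 : 0 ≤ B x₀ + 1 := h3.trans h1
  gcongr

/-! ### Modified Bessel functions -/

theorem abs_besselI_term_le (n r : ℕ) (x : ℝ) :
    |(x / 2) ^ (2 * r + n) / ((r.factorial : ℝ) * ((r + n).factorial : ℝ))| ≤
      |x| ^ (2 * r + n) / ((2 * r + n).factorial : ℝ) := by
  have h : (2 * r + n).factorial ≤ 2 ^ (2 * r + n) * (r.factorial * (r + n).factorial) := by
    have h1 := Nat.choose_le_two_pow (2 * r + n) r
    have h2 := Nat.choose_mul_factorial_mul_factorial (show r ≤ 2 * r + n by omega)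
    rw [show 2 * r + n - r = r + n by omega, mul_assoc] at h2
    rw [← h2]
    exact Nat.mul_le_mul_right _ h1
  rw [abs_div, abs_pow, abs_div, abs_two, abs_of_pos (by positivity :
    (0 : ℝ) < (r.factorial : ℝ) * ((r + n).factorial : ℝ)), div_pow, div_div]
  refine div_le_div_of_nonneg_left (by positivity) (by positivity) ?_
  exact_mod_cast h

theorem summable_besselI (n : ℕ) (x : ℝ) : Summable fun r : ℕ =>
    (x / 2) ^ (2 * r + n) / ((r.factorial : ℝ) * ((r + n).factorial : ℝ)) := by
  refine Summable.of_norm_bounded (g := fun r : ℕ =>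
    |x| ^ (2 * r + n) / ((2 * r + n).factorial : ℝ)) ?_ (abs_besselI_term_le n · x)
  exact (hasSum_exp |x|).summable.comp_injective (i := fun r => 2 * r + n)
    fun a b h => by simpa using h

theorem hasSum_besselI (n : ℕ) (x : ℝ) : HasSum (fun r : ℕ =>
    (x / 2) ^ (2 * r + n) / ((r.factorial : ℝ) * ((r + n).factorial : ℝ))) (besselI n x) := by
  simpa [besselI] using (summable_besselI n x).hasSum

theorem abs_besselI_le (n : ℕ) (x : ℝ) : |besselI n x| ≤ Real.exp |x| := by
  have hinj : Function.Injective fun r : ℕ => 2 * r + n := fun a b h => by simpa using h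
  have hs := (hasSum_exp |x|).summable
  rw [← (hasSum_besselI n x).tsum_eq, ← (hasSum_exp |x|).tsum_eq]
  refine (tsum_of_norm_bounded (hs.comp_injective hinj).hasSum
    (f := fun r : ℕ => (x / 2) ^ (2 * r + n) / ((r.factorial : ℝ) * ((r + n).factorial : ℝ)))
    fun r => abs_besselI_term_le n r x).trans ?_
  exact tsum_comp_le_tsum_of_inj hs (fun i => by positivity) hinj

theorem continuous_besselI (n : ℕ) : Continuous (besselI n) := by
  have : besselI n = fun x => ∑' r : ℕ,
      (x / 2) ^ (2 * r + n) / ((r.factorial : ℝ) * ((r + n).factorial : ℝ)) := by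
    funext x
    exact (hasSum_besselI n x).tsum_eq.symm
  rw [this]
  refine continuous_tsum_of_le_exp_series (B := fun x => |x / 2| ^ n)
    (R := fun x => |x / 2| ^ 2) (fun r => by fun_prop) (by fun_prop) (by fun_prop)
    (fun x => by positivity) fun r x => ?_
  rw [abs_div, abs_pow, pow_add, pow_mul, abs_of_pos (by positivity :
    (0 : ℝ) < (r.factorial : ℝ) * ((r + n).factorial : ℝ))]
  rw [mul_comm _ (|x / 2| ^ n), mul_div_assoc]
  gcongr
  have : (1 : ℝ) ≤ ((r + n).factorial : ℝ) := by
    exact_mod_cast Nat.one_le_iff_ne_zero.2 (by positivity)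
  exact le_mul_of_one_le_right (by positivity) this

/-! ### The Poisson series of the Marcum `Q`-function -/

/-- The series `e^{-w-y} ∑_{s ≥ 0} (w^s / s!) ∑_{0 ≤ i ≤ s+M-1} y^i / i!`, which equals
`Q_M(√(2w), √(2y))`. Unlike `marcumQ` it is continuous at `w = 0`. -/
def marcumSeries (M : ℤ) (w y : ℝ) : ℝ :=
  Real.exp (-(w + y)) * ∑' s : ℕ, w ^ s / (s.factorial : ℝ) * expPartial (s + M - 1) y

theorem summable_marcumSeries (M : ℤ) (w y : ℝ) :
    Summable fun s : ℕ => w ^ s / (s.factorial : ℝ) * expPartial (s + M - 1) y := by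
  refine Summable.of_norm_bounded ((hasSum_exp |w|).summable.mul_right (Real.exp |y|)) fun s => ?_
  rw [norm_mul, norm_div, norm_pow]
  simp only [Real.norm_eq_abs, Nat.abs_cast]
  gcongr
  exact abs_expPartial_le _ _

theorem hasSum_marcumSeries (M : ℤ) (w y : ℝ) :
    HasSum (fun s : ℕ => Real.exp (-(w + y)) *
      (w ^ s / (s.factorial : ℝ) * expPartial (s + M - 1) y)) (marcumSeries M w y) :=
  (summable_marcumSeries M w y).hasSum.mul_left _

theorem marcumSeries_nonneg (M : ℤ) {w y : ℝ} (hw : 0 ≤ w) (hy : 0 ≤ y) :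
    0 ≤ marcumSeries M w y :=
  mul_nonneg (Real.exp_pos _).le (tsum_nonneg fun _ =>
    mul_nonneg (by positivity) (expPartial_nonneg _ hy))

theorem marcumSeries_le_one (M : ℤ) {w y : ℝ} (hw : 0 ≤ w) (hy : 0 ≤ y) :
    marcumSeries M w y ≤ 1 := by
  have h := (summable_marcumSeries M w y).tsum_le_tsum
    (fun s => mul_le_mul_of_nonneg_left (expPartial_le_exp _ hy) (by positivity))
    ((hasSum_exp w).summable.mul_right (Real.exp y))
  rw [((hasSum_exp w).mul_right (Real.exp y)).tsum_eq, ← Real.exp_add] at h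
  calc marcumSeries M w y ≤ Real.exp (-(w + y)) * Real.exp (w + y) :=
        mul_le_mul_of_nonneg_left h (Real.exp_pos _).le
    _ = 1 := by rw [← Real.exp_add, neg_add_cancel, Real.exp_zero]

theorem continuous_marcumSeries (M : ℤ) :
    Continuous fun p : ℝ × ℝ => marcumSeries M p.1 p.2 := by
  unfold marcumSeries
  refine Continuous.mul (by fun_prop) ?_
  refine continuous_tsum_of_le_exp_series (B := fun p : ℝ × ℝ => Real.exp |p.2|)
    (R := fun p => |p.1|) (fun r => ?_) (by fun_prop) (by fun_prop)
    (fun x => by positivity) fun r p => ?_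
  · exact Continuous.mul (by fun_prop) ((continuous_expPartial _).comp continuous_snd)
  · rw [abs_mul, abs_div, abs_pow, Nat.abs_cast, mul_comm (Real.exp _)]
    gcongr
    exact abs_expPartial_le _ _

/-- Series of `Q_{2c+k+1,k}(a,b)`, obtained by integrating the series of `I_k` termwise. -/
theorem hasSum_nuttallQ (c k : ℕ) (a b : ℝ) :
    HasSum (fun r : ℕ => Real.exp (-(a ^ 2 / 2 + b ^ 2 / 2)) *
      ((a / 2) ^ (2 * r + k) * 2 ^ (r + (c + k)) * ((r + (c + k)).factorial : ℝ) /
        ((r.factorial : ℝ) * ((r + k).factorial : ℝ)) *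
        expPartial ((r + (c + k) : ℕ) : ℤ) (b ^ 2 / 2)))
      (nuttallQ (2 * c + k + 1) k a b) := by
  have hfac : ∀ r : ℕ, ((r + (c + k)).factorial : ℝ) ≤
      2 ^ (r + (c + k)) * ((c.factorial : ℝ) * ((r + k).factorial : ℝ)) := fun r => by
    have h1 := Nat.choose_le_two_pow (r + (c + k)) c
    have h2 := Nat.choose_mul_factorial_mul_factorial (show c ≤ r + (c + k) by omega)
    rw [show r + (c + k) - c = r + k by omega, mul_assoc] at h2
    have h3 := Nat.mul_le_mul_right (c.factorial * (r + k).factorial) h1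
    rw [h2] at h3
    exact_mod_cast h3
  have key := hasSum_integral_odd_series (δ := 1 / 2) (by norm_num) (c + k)
    (fun r => Real.exp (-(a ^ 2 / 2)) *
      ((a / 2) ^ (2 * r + k) / ((r.factorial : ℝ) * ((r + k).factorial : ℝ)))) ?_ b
  · convert key using 1
    · funext r
      rw [neg_add, Real.exp_add, show (1 / 2 : ℝ) * b ^ 2 = b ^ 2 / 2 by ring,
        show (2 : ℝ) * (1 / 2) ^ (r + (c + k) + 1) = (2 ^ (r + (c + k)))⁻¹ by
          rw [pow_succ, one_div, inv_pow]; ring]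
      rw [div_inv_eq_mul]
      ring
    · rw [nuttallQ]
      refine integral_congr_ae (ae_of_all _ fun x => ?_)
      simp only
      rw [← (hasSum_besselI k (a * x)).tsum_eq, ← tsum_mul_left]
      refine tsum_congr fun r => ?_
      rw [show -(x ^ 2 + a ^ 2) / 2 = -(a ^ 2 / 2) + -(1 / 2) * x ^ 2 by ring, Real.exp_add]
      rw [show 2 * (r + (c + k)) + 1 = (2 * c + k + 1) + (2 * r + k) by ring, pow_add x,
        mul_div_right_comm a x 2, mul_pow (a / 2) x]
      ring
  · refine Summable.of_nonneg_of_le (fun r => by positivity) (fun r => ?_)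
      ((hasSum_exp (a ^ 2)).summable.mul_left
        (Real.exp (-(a ^ 2 / 2)) * |a / 2| ^ k * c.factorial * 2 ^ (c + k)))
    have h := hfac r
    rw [abs_mul, Real.abs_exp, abs_div, abs_pow,
      abs_of_pos (by positivity : (0 : ℝ) < (r.factorial : ℝ) * ((r + k).factorial : ℝ))]
    calc _ ≤ Real.exp (-(a ^ 2 / 2)) *
          (|a / 2| ^ (2 * r + k) / ((r.factorial : ℝ) * ((r + k).factorial : ℝ))) *
          ((2 ^ (r + (c + k)) * ((c.factorial : ℝ) * ((r + k).factorial : ℝ))) / (1 / 2) ^ r) := by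
          gcongr
      _ = _ := by
          rw [pow_add |a / 2|, pow_mul, sq_abs,
            show (a / 2) ^ 2 = a ^ 2 * (1 / 2) * (1 / 2) by ring,
            mul_pow, mul_pow, one_div_pow, pow_add 2 r]
          field_simp

theorem marcumQ_of_pos (n : ℕ) {a : ℝ} (ha : a ≠ 0 ∨ n = 0) (b : ℝ) :
    marcumQ ((n : ℤ) + 1) a b = marcumSeries (n + 1) (a ^ 2 / 2) (b ^ 2 / 2) := by
  have han : a ^ n ≠ 0 := by
    rcases ha with ha | rfl
    · exact pow_ne_zero _ ha
    · simp
  have h1 : marcumQ ((n : ℤ) + 1) a b = 1 / a ^ n * nuttallQ (2 * 0 + n + 1) n a b := by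
    rw [marcumQ, nuttallQ, add_sub_cancel_right]
    norm_cast
    simp
  have h2 := (hasSum_nuttallQ 0 n a b).mul_left (1 / a ^ n)
  rw [h1]
  refine h2.unique ?_
  refine (hasSum_marcumSeries (n + 1) (a ^ 2 / 2) (b ^ 2 / 2)).congr_term fun r => ?_
  rw [show (r : ℤ) + (n + 1) - 1 = ((r + (0 + n) : ℕ) : ℤ) by push_cast; ring, pow_add (a / 2),
    pow_mul, div_pow a 2 n, pow_add 2 r, zero_add, show (a / 2) ^ 2 = (a ^ 2 / 2) / 2 by ring,
    div_pow (a ^ 2 / 2) 2 r]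
  field_simp

theorem marcumQ_of_nonpos (d : ℕ) {a b : ℝ} (ha : a ≠ 0) (hb : 0 ≤ b) :
    marcumQ (1 - (d : ℤ)) a b = marcumSeries (1 - d) (a ^ 2 / 2) (b ^ 2 / 2) := by
  have key := hasSum_integral_odd_series (δ := 1 / 2) (by norm_num) 0
    (fun r => Real.exp (-(a ^ 2 / 2)) *
      ((a / 2) ^ (2 * r + d) / ((r.factorial : ℝ) * ((r + d).factorial : ℝ)))) ?_ b
  · have h1 : marcumQ (1 - (d : ℤ)) a b = a ^ d * ∫ x in Set.Ioi b, ∑' r : ℕ,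
        (fun r => Real.exp (-(a ^ 2 / 2)) *
          ((a / 2) ^ (2 * r + d) / ((r.factorial : ℝ) * ((r + d).factorial : ℝ)))) r *
          (x ^ (2 * (r + 0) + 1) * Real.exp (-(1 / 2) * x ^ 2)) := by
      rw [marcumQ, show 1 - (d : ℤ) - 1 = -d by ring, zpow_neg, one_div, inv_inv, zpow_natCast]
      congr 1
      refine setIntegral_congr_fun measurableSet_Ioi fun x hx => ?_
      have hx0 : x ≠ 0 := (lt_of_le_of_lt hb hx).ne'
      simp only
      rw [show besselI (-(d : ℤ)) (a * x) = besselI d (a * x) by simp [besselI],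
        ← (hasSum_besselI d (a * x)).tsum_eq, ← tsum_mul_left]
      refine tsum_congr fun r => ?_
      rw [show -(x ^ 2 + a ^ 2) / 2 = -(a ^ 2 / 2) + -(1 / 2) * x ^ 2 by ring, Real.exp_add,
        mul_div_right_comm a x 2, mul_pow (a / 2) x, zpow_sub₀ hx0, zpow_one, zpow_natCast,
        pow_add x (2 * r) d]
      field_simp
      ring
    rw [h1]
    refine (key.mul_left (a ^ d)).unique ?_
    -- The first `d` terms of the Marcum series are empty sums.
    have h3 := (hasSum_nat_add_iff' d).2 (hasSum_marcumSeries (1 - d) (a ^ 2 / 2) (b ^ 2 / 2))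
    rw [Finset.sum_eq_zero, sub_zero] at h3
    · refine h3.congr_term fun r => ?_
      rw [show ((r + d : ℕ) : ℤ) + (1 - d) - 1 = ((r + 0 : ℕ) : ℤ) by push_cast; ring,
        neg_add, Real.exp_add, show (1 / 2 : ℝ) * b ^ 2 = b ^ 2 / 2 by ring,
        show (2 : ℝ) * (1 / 2) ^ (r + 0 + 1) = (2 ^ r)⁻¹ by
          rw [pow_succ, one_div, inv_pow]; ring]
      rw [pow_add (a / 2), pow_mul, div_pow a 2 d, show (a / 2) ^ 2 = (a ^ 2 / 2) / 2 by ring,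
        div_pow (a ^ 2 / 2) 2 r, pow_add _ r d, div_pow (a ^ 2) 2 d, ← pow_mul a 2 d,
        add_zero]
      field_simp
      ring
    · intro s hs
      rw [Finset.mem_range] at hs
      rw [expPartial_of_neg (by omega), mul_zero, mul_zero]
  · refine Summable.of_nonneg_of_le (fun r => by positivity) (fun r => ?_)
      ((hasSum_exp (a ^ 2 / 2)).summable.mul_left (Real.exp (-(a ^ 2 / 2)) * |a / 2| ^ d))
    have h : (1 : ℝ) ≤ ((r + d).factorial : ℝ) := by
      exact_mod_cast Nat.one_le_iff_ne_zero.2 (by positivity)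
    rw [abs_mul, Real.abs_exp, abs_div, abs_pow,
      abs_of_pos (by positivity : (0 : ℝ) < (r.factorial : ℝ) * ((r + d).factorial : ℝ))]
    calc _ ≤ Real.exp (-(a ^ 2 / 2)) *
          (|a / 2| ^ (2 * r + d) / ((r.factorial : ℝ) * (r.factorial : ℝ))) *
          (((r + 0).factorial : ℝ) / (1 / 2) ^ r) := by
          have : (r.factorial : ℝ) ≤ ((r + d).factorial : ℝ) := by
            exact_mod_cast Nat.factorial_le (by omega)
          gcongr
      _ = _ := by
          rw [pow_add |a / 2|, pow_mul, sq_abs, add_zero,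
            show (a / 2) ^ 2 = (a ^ 2 / 2) * (1 / 2) by ring, mul_pow]
          field_simp

/-- The Marcum `Q`-function as a Poisson series, in all cases in which its integral is not
affected by the junk values of `marcumQ`. -/
theorem marcumQ_eq_marcumSeries (M : ℤ) {a b : ℝ} (ha : a ≠ 0 ∨ M = 1) (hb : 1 ≤ M ∨ 0 ≤ b) :
    marcumQ M a b = marcumSeries M (a ^ 2 / 2) (b ^ 2 / 2) := by
  rcases le_or_gt 1 M with h | h
  · obtain ⟨n, rfl⟩ : ∃ n : ℕ, M = n + 1 := ⟨(M - 1).toNat, by omega⟩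
    exact marcumQ_of_pos n (ha.imp id fun h => by omega) b
  · obtain ⟨d, rfl⟩ : ∃ d : ℕ, M = 1 - d := ⟨(1 - M).toNat, by omega⟩
    exact marcumQ_of_nonpos d (ha.resolve_right (by omega)) (hb.resolve_left (by omega))

/-! ### The Nuttall function through Marcum and Bessel functions -/

theorem sum_Icc_one (f : ℕ → ℝ) (n : ℕ) :
    ∑ l ∈ Finset.Icc 1 n, f l = ∑ l ∈ Finset.range n, f (l + 1) := by
  have : Finset.Icc 1 n = Finset.Ico 1 (n + 1) := by
    ext
    simp
  rw [this, Finset.sum_Ico_eq_sum_range, add_tsub_cancel_right]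
  exact Finset.sum_congr rfl fun i _ => by rw [add_comm]

/-- Reindexing `r = s + l` of a series `∑ F(s + l) / s!`. -/
theorem HasSum.descFactorial_shift (l : ℕ) (F : ℕ → ℝ) {S : ℝ}
    (h : HasSum (fun s : ℕ => F (s + l) / (s.factorial : ℝ)) S) :
    HasSum (fun r : ℕ => (r.descFactorial l : ℝ) / (r.factorial : ℝ) * F r) S := by
  rw [← hasSum_nat_add_iff' l, Finset.sum_eq_zero, sub_zero]
  · refine h.congr_term fun s => ?_
    have := Nat.factorial_mul_descFactorial (show l ≤ s + l by omega)
    rw [Nat.add_sub_cancel] at this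
    have h2 : ((s + l).factorial : ℝ) = (s.factorial : ℝ) * ((s + l).descFactorial l : ℝ) := by
      exact_mod_cast this.symm
    have h3 : ((s + l).descFactorial l : ℝ) ≠ 0 := by
      have : ((s + l).factorial : ℝ) ≠ 0 := by positivity
      rw [h2] at this
      exact right_ne_zero_of_mul this
    rw [h2]
    field_simp
  · intro r hr
    rw [Nat.descFactorial_eq_zero_iff_lt.2 (Finset.mem_range.1 hr)]
    simp

/-- Vandermonde's convolution with falling factorials. -/
theorem sum_factorial_choose_descFactorial (A d r : ℕ) (hd : d ≤ A) :
    ∑ l ∈ Finset.range (d + 1), (d.factorial : ℝ) / (l.factorial : ℝ) * (A.choose (d - l) : ℝ) *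
      (r.descFactorial l : ℝ) = ((r + A).factorial : ℝ) / ((r + A - d).factorial : ℝ) := by
  have h1 := Nat.add_choose_eq r A d
  rw [Finset.Nat.sum_antidiagonal_eq_sum_range_succ_mk] at h1
  have h2 := Nat.choose_mul_factorial_mul_factorial (show d ≤ r + A by omega)
  rw [h1] at h2
  rw [← h2]
  push_cast
  rw [mul_div_assoc, div_self (by positivity), mul_one, Finset.sum_mul]
  refine Finset.sum_congr rfl fun l _ => ?_
  rw [Nat.descFactorial_eq_factorial_mul_choose]
  push_cast
  field_simp

/-- The closed form of `Q_{2c+k+1,k}(a,b)` with the Marcum functions replaced by their series, which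
makes it visibly continuous in `(a, b)`. -/
def nuttallSeries (c k : ℕ) (a b : ℝ) : ℝ :=
  (∑ l ∈ Finset.range (c + 1),
      omegaCoeff (l + 1) k c * a ^ (k + 2 * l) *
        marcumSeries ((k : ℤ) + l + 1) (a ^ 2 / 2) (b ^ 2 / 2)) +
    Real.exp (-(a ^ 2 / 2 + b ^ 2 / 2)) *
      ∑ l ∈ Finset.range c,
        pCoeff c (l + 1) k (b ^ 2) * a ^ l * b ^ (k + l + 2) *
          besselI ((k + l : ℕ) : ℤ) (a * b)

theorem nuttallClosed_eq_nuttallSeries (c k : ℕ) (a b : ℝ) :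
    nuttallClosed c k a b = nuttallSeries c k a b := by
  rw [nuttallClosed, nuttallSeries, sum_Icc_one, sum_Icc_one]
  congr 1
  · refine Finset.sum_congr rfl fun l _ => ?_
    rw [Nat.add_sub_cancel]
    -- At `a = 0` the value of `marcumQ` is junk unless its index is `1`, but then and only then the
    -- power of `a` in front of it does not vanish.
    by_cases h : a ^ (k + 2 * l) = 0
    · simp [h]
    · rw [marcumQ_eq_marcumSeries _ _ (Or.inl (by omega))]
      · push_cast
        rw [add_assoc]
      · by_contra! hc
        obtain ⟨rfl, h1⟩ := hc
        refine h (zero_pow ?_)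
        omega
  · congr 1
    · ring_nf
    · refine Finset.sum_congr rfl fun l _ => ?_
      rw [Nat.add_sub_cancel, show ((k : ℤ) + ((l + 1 : ℕ) : ℤ) - 1) = ((k + l : ℕ) : ℤ) by
        push_cast; ring]
      rfl

/-- The coefficient of `E_{r+k}` in the Marcum part equals the coefficient of `E_{r+c+k}` in the
series of `Q_{2c+k+1,k}`. -/
theorem sum_omegaCoeff_terms (c k r : ℕ) (a : ℝ) :
    ∑ l ∈ Finset.range (c + 1), omegaCoeff (l + 1) k c * a ^ (k + 2 * l) *
      ((r.descFactorial l : ℝ) / (r.factorial : ℝ) * (a ^ 2 / 2) ^ (r - l)) =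
    (a / 2) ^ (2 * r + k) * 2 ^ (r + (c + k)) * ((r + (c + k)).factorial : ℝ) /
        ((r.factorial : ℝ) * ((r + k).factorial : ℝ)) := by
  have hV := sum_factorial_choose_descFactorial (c + k) c r (by omega)
  rw [show r + (c + k) - c = r + k by omega] at hV
  rw [mul_div_assoc, mul_comm (r.factorial : ℝ), ← div_div ((r + (c + k)).factorial : ℝ), ← hV,
    Finset.sum_div, Finset.mul_sum]
  refine Finset.sum_congr rfl fun l hl => ?_
  rw [Finset.mem_range] at hl
  rcases lt_or_ge r l with h | h
  · simp [Nat.descFactorial_eq_zero_iff_lt.2 h]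
  obtain ⟨s, rfl⟩ := Nat.exists_eq_add_of_le h
  obtain ⟨t, rfl⟩ := Nat.exists_eq_add_of_le (show l ≤ c by omega)
  rw [omegaCoeff, show l + t + 1 - (l + 1) = t by omega, show l + t - l = t by omega,
    show l + 1 - 1 = l by omega, show l + s - l = s by omega]
  have : (a / 2) ^ (2 * (l + s) + k) * 2 ^ (l + s + (l + t + k)) =
      2 ^ t * a ^ (k + 2 * l) * (a ^ 2 / 2) ^ s := by
    rw [div_pow, div_pow]
    field_simp
    ring
  rw [this]
  ring

/-- The `r`-th coefficient of the Bessel part accounts for `E_{r+c+k} - E_{r+k}`. After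
interchanging the sums over `l` and over the index `i` of `pCoeff`, each `i` is one instance of
Vandermonde's convolution. -/
theorem sum_pCoeff_terms (c k r : ℕ) (a b : ℝ) :
    ∑ l ∈ Finset.range c, pCoeff c (l + 1) k (b ^ 2) * a ^ l * b ^ (k + l + 2) *
      ((r.descFactorial l : ℝ) / (r.factorial : ℝ) *
        ((a * b / 2) ^ (2 * r + k - l) / ((r + k).factorial : ℝ))) =
    (a / 2) ^ (2 * r + k) * 2 ^ (r + (c + k)) * ((r + (c + k)).factorial : ℝ) /
        ((r.factorial : ℝ) * ((r + k).factorial : ℝ)) *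
      ∑ i ∈ Finset.range c, (b ^ 2 / 2) ^ (r + k + 1 + i) / ((r + k + 1 + i).factorial : ℝ) := by
  simp only [pCoeff, Finset.sum_mul, Finset.mul_sum]
  rw [Finset.sum_comm' (s' := fun i => Finset.range (c - i)) (t' := Finset.range c)
    (by intro x y; simp only [Finset.mem_range]; omega)]
  refine Finset.sum_congr rfl fun i hi => ?_
  rw [Finset.mem_range] at hi
  have hV := sum_factorial_choose_descFactorial (c + k) (c - 1 - i) r (by omega)
  rw [show r + (c + k) - (c - 1 - i) = r + k + 1 + i by omega,
    show c - 1 - i + 1 = c - i by omega] at hV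
  have : (a / 2) ^ (2 * r + k) * 2 ^ (r + (c + k)) * ((r + (c + k)).factorial : ℝ) /
        ((r.factorial : ℝ) * ((r + k).factorial : ℝ)) *
      ((b ^ 2 / 2) ^ (r + k + 1 + i) / ((r + k + 1 + i).factorial : ℝ)) =
      (a / 2) ^ (2 * r + k) * 2 ^ (r + (c + k)) * (b ^ 2 / 2) ^ (r + k + 1 + i) /
        ((r.factorial : ℝ) * ((r + k).factorial : ℝ)) *
      (((r + (c + k)).factorial : ℝ) / ((r + k + 1 + i).factorial : ℝ)) := by
    ring
  rw [this, ← hV, Finset.mul_sum]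
  refine Finset.sum_congr rfl fun l hl => ?_
  rw [Finset.mem_range] at hl
  rcases lt_or_ge r l with h | h
  · simp [Nat.descFactorial_eq_zero_iff_lt.2 h]
  obtain ⟨s, rfl⟩ := Nat.exists_eq_add_of_le h
  obtain ⟨t, rfl⟩ := Nat.exists_eq_add_of_le (show l + i + 1 ≤ c by omega)
  rw [show l + i + 1 + t - (l + 1) - i = t by omega, show l + 1 - 1 = l by omega,
    show l + i + 1 + t - 1 - i - l = t by omega,
    show 2 * (l + s) + k - l = l + 2 * s + k by omega]
  have : (a / 2) ^ (2 * (l + s) + k) * 2 ^ (l + s + (l + i + 1 + t + k)) *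
      (b ^ 2 / 2) ^ (l + s + k + 1 + i) =
      2 ^ t * (b ^ 2) ^ i * a ^ l * b ^ (k + l + 2) * (a * b / 2) ^ (l + 2 * s + k) := by
    rw [div_pow, div_pow, div_pow]
    field_simp
    ring
  rw [this]
  ring

theorem nuttallQ_eq_nuttallSeries (c k : ℕ) (a b : ℝ) :
    nuttallQ (2 * c + k + 1) k a b = nuttallSeries c k a b := by
  set X := Real.exp (-(a ^ 2 / 2 + b ^ 2 / 2)) with hX
  have h1 : ∀ l ∈ Finset.range (c + 1), HasSum (fun r : ℕ =>
      omegaCoeff (l + 1) k c * a ^ (k + 2 * l) * (X * ((r.descFactorial l : ℝ) /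
        (r.factorial : ℝ) * ((a ^ 2 / 2) ^ (r - l) * expPartial ((r + k : ℕ) : ℤ) (b ^ 2 / 2)))))
      (omegaCoeff (l + 1) k c * a ^ (k + 2 * l) *
        marcumSeries ((k : ℤ) + l + 1) (a ^ 2 / 2) (b ^ 2 / 2)) := fun l _ => by
    refine HasSum.mul_left _ (HasSum.mul_left _ (HasSum.descFactorial_shift l (fun r =>
      (a ^ 2 / 2) ^ (r - l) * expPartial ((r + k : ℕ) : ℤ) (b ^ 2 / 2)) ?_))
    refine (summable_marcumSeries _ _ _).hasSum.congr_term fun s => ?_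
    rw [Nat.add_sub_cancel, show (s : ℤ) + (k + l + 1) - 1 = ((s + l + k : ℕ) : ℤ) by
      push_cast; ring]
    ring
  have h2 : ∀ l ∈ Finset.range c, HasSum (fun r : ℕ =>
      pCoeff c (l + 1) k (b ^ 2) * a ^ l * b ^ (k + l + 2) * ((r.descFactorial l : ℝ) /
        (r.factorial : ℝ) * ((a * b / 2) ^ (2 * r + k - l) / ((r + k).factorial : ℝ))))
      (pCoeff c (l + 1) k (b ^ 2) * a ^ l * b ^ (k + l + 2) *
          besselI ((k + l : ℕ) : ℤ) (a * b)) := fun l _ => by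
    refine HasSum.mul_left _ (HasSum.descFactorial_shift l (fun r =>
      (a * b / 2) ^ (2 * r + k - l) / ((r + k).factorial : ℝ)) ?_)
    refine (hasSum_besselI (k + l) (a * b)).congr_term fun s => ?_
    rw [show 2 * (s + l) + k - l = 2 * s + (k + l) by omega,
      show s + l + k = s + (k + l) by omega, div_div, mul_comm (s.factorial : ℝ)]
  refine (hasSum_nuttallQ c k a b).unique
    (((hasSum_sum h1).add ((hasSum_sum h2).mul_left X)).congr_term fun r => ?_)
  rw [sum_pCoeff_terms, ← hX]
  have h3 := sum_omegaCoeff_terms c k r a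
  have h4 : expPartial ((r + (c + k) : ℕ) : ℤ) (b ^ 2 / 2) =
      expPartial ((r + k : ℕ) : ℤ) (b ^ 2 / 2) + ∑ i ∈ Finset.range c,
        (b ^ 2 / 2) ^ (r + k + 1 + i) / ((r + k + 1 + i).factorial : ℝ) := by
    rw [expPartial_natCast, expPartial_natCast,
      show r + (c + k) + 1 = r + k + 1 + c by ring, Finset.sum_range_add]
  rw [h4, ← h3, mul_add, mul_add, Finset.sum_mul, Finset.mul_sum]
  congr 1
  exact Finset.sum_congr rfl fun l _ => by ring

theorem nuttallQ_eq_nuttallClosed (c k : ℕ) (a b : ℝ) :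
    nuttallQ (2 * c + k + 1) k a b = nuttallClosed c k a b := by
  rw [nuttallQ_eq_nuttallSeries, nuttallClosed_eq_nuttallSeries]

/-! ### The regularized confluent hypergeometric function -/

theorem hasSum_ite_le_expPartial (n : ℤ) (y : ℝ) :
    HasSum (fun q : ℕ => if (q : ℤ) ≤ n then y ^ q / (q.factorial : ℝ) else 0)
      (expPartial n y) := by
  have h : expPartial n y = ∑ q ∈ Finset.range (n + 1).toNat,
      if (q : ℤ) ≤ n then y ^ q / (q.factorial : ℝ) else 0 := by
    refine Finset.sum_congr rfl fun q hq => ?_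
    rw [Finset.mem_range] at hq
    rw [if_pos (by omega)]
  rw [h]
  refine hasSum_sum_of_ne_finset_zero fun q hq => ?_
  rw [Finset.mem_range] at hq
  rw [if_neg (by omega)]

theorem inv_Gamma_eq_mul_inv_Gamma_add_one (x : ℝ) :
    (Real.Gamma x)⁻¹ = x * (Real.Gamma (x + 1))⁻¹ := by
  rcases eq_or_ne x 0 with rfl | hx
  · simp
  · rw [Real.Gamma_add_one hx, mul_inv, ← mul_assoc, mul_inv_cancel₀ hx, one_mul]

/-- The terms of `Φ₃` on the ray `z = w y` are terms of the exponential series of `w`. -/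
theorem zpow_mul_inv_Gamma (c : ℤ) (p q : ℕ) (w : ℝ) (hw : w ≠ 0) :
    (Real.Gamma ((c : ℝ) + p + q))⁻¹ * w ^ p * w ^ q = w ^ (1 - c) * expTerm (c - 1 + q + p) w := by
  rw [expTerm, ← mul_assoc, ← zpow_add₀ hw, show 1 - c + (c - 1 + q + p) = (p : ℤ) + q by ring,
    zpow_add₀ hw, zpow_natCast, zpow_natCast]
  push_cast
  rw [show (c : ℝ) - 1 + q + p + 1 = c + p + q by ring]
  ring

/-- With `d = max (1 - c) 0` one has `1 / (m - d)! = d! C(m,d) / m! ≤ d! 2^m / m!`, which bounds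
`1 / Γ(c+m)` whether or not `c` is positive. -/
theorem abs_inv_Gamma_int_add_le (c : ℤ) (m : ℕ) :
    |(Real.Gamma ((c : ℝ) + m))⁻¹| ≤
      ((1 - c).toNat.factorial : ℝ) * 2 ^ m / (m.factorial : ℝ) := by
  have h1 : (Real.Gamma ((c : ℝ) + m))⁻¹ = expTerm (c - 1 + m) 1 := by
    rw [expTerm, one_zpow, one_mul]
    push_cast
    rw [show (c : ℝ) - 1 + m + 1 = c + m by ring]
  rw [h1]
  set d := (1 - c).toNat with hd
  rcases lt_or_ge (c - 1 + m) 0 with h | h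
  · rw [expTerm_of_neg h, abs_zero]
    positivity
  · obtain ⟨n, hn⟩ := Int.eq_ofNat_of_zero_le h
    rw [hn, expTerm_natCast, one_pow, abs_of_nonneg (by positivity)]
    have hdm : d ≤ m := by omega
    have h2 := Nat.choose_le_two_pow m d
    have h3 := Nat.choose_mul_factorial_mul_factorial hdm
    have h4 : (m - d).factorial ≤ n.factorial := Nat.factorial_le (by omega)
    rw [div_le_div_iff₀ (by positivity) (by positivity), one_mul]
    norm_cast
    calc m.factorial = m.choose d * d.factorial * (m - d).factorial := h3.symm
      _ ≤ 2 ^ m * d.factorial * n.factorial := by gcongr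
      _ = _ := by ring

theorem ascPochhammer_eval_succ_div_factorial (b p : ℕ) :
    (ascPochhammer ℝ p).eval ((b + 1 : ℕ) : ℝ) / (p.factorial : ℝ) = ((b + p).choose p : ℝ) := by
  rw [← ascPochhammer_eval_cast, ascPochhammer_nat_eq_ascFactorial,
    Nat.ascFactorial_eq_factorial_mul_choose]
  push_cast
  field_simp

theorem summable_phi3Reg (b : ℕ) (c : ℤ) (w z : ℝ) :
    Summable fun p : ℕ × ℕ => (ascPochhammer ℝ p.1).eval ((b + 1 : ℕ) : ℝ) *
      (Real.Gamma ((c : ℝ) + p.1 + p.2))⁻¹ * w ^ p.1 * z ^ p.2 /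
        ((p.1.factorial : ℝ) * (p.2.factorial : ℝ)) := by
  set D : ℝ := ((1 - c).toNat.factorial : ℝ)
  have hs : Summable fun p : ℕ × ℕ => (2 ^ b * D) * ((4 * |w|) ^ p.1 / (p.1.factorial : ℝ) *
      ((2 * |z|) ^ p.2 / (p.2.factorial : ℝ))) :=
    (Summable.mul_of_nonneg (hasSum_exp (4 * |w|)).summable (hasSum_exp (2 * |z|)).summable
      (fun i => by positivity) (fun i => by positivity)).mul_left _
  refine Summable.of_norm_bounded hs ?_
  rintro ⟨p, q⟩
  have h1 : ((b + p).choose p : ℝ) ≤ 2 ^ (b + p) := by exact_mod_cast Nat.choose_le_two_pow _ _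
  have h2 := abs_inv_Gamma_int_add_le c (p + q)
  have h3 : D * 2 ^ (p + q) / ((p + q).factorial : ℝ) ≤ D * 2 ^ (p + q) / (p.factorial : ℝ) := by
    have : (p.factorial : ℝ) ≤ ((p + q).factorial : ℝ) := by
      exact_mod_cast Nat.factorial_le (by omega)
    gcongr
  have h4 := h2.trans h3
  push_cast at h4
  rw [← add_assoc] at h4
  simp only
  rw [show (ascPochhammer ℝ p).eval ((b + 1 : ℕ) : ℝ) * (Real.Gamma ((c : ℝ) + p + q))⁻¹ * w ^ p *
      z ^ q / ((p.factorial : ℝ) * (q.factorial : ℝ)) =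
      ((ascPochhammer ℝ p).eval ((b + 1 : ℕ) : ℝ) / (p.factorial : ℝ)) *
      (Real.Gamma ((c : ℝ) + p + q))⁻¹ * (w ^ p * (z ^ q / (q.factorial : ℝ))) by ring,
    ascPochhammer_eval_succ_div_factorial, Real.norm_eq_abs, abs_mul, abs_mul, Nat.abs_cast,
    abs_mul, abs_div, abs_pow, abs_pow, Nat.abs_cast]
  calc _ ≤ 2 ^ (b + p) * (D * 2 ^ (p + q) / (p.factorial : ℝ)) *
        (|w| ^ p * (|z| ^ q / (q.factorial : ℝ))) := by gcongr
    _ = _ := by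
      rw [mul_pow, mul_pow, show (4 : ℝ) = 2 * 2 by norm_num, mul_pow]
      ring

theorem hasSum_phi3Reg (b : ℕ) (c : ℤ) (w z : ℝ) :
    HasSum (fun p : ℕ × ℕ => (ascPochhammer ℝ p.1).eval ((b + 1 : ℕ) : ℝ) *
      (Real.Gamma ((c : ℝ) + p.1 + p.2))⁻¹ * w ^ p.1 * z ^ p.2 /
        ((p.1.factorial : ℝ) * (p.2.factorial : ℝ))) (phi3Reg ((b + 1 : ℕ) : ℝ) c w z) :=
  (summable_phi3Reg b c w z).hasSum

/-- The contiguous relation `b w Φ(b+1,c) = Φ(b,c-2) - (c-2) Φ(b,c-1) - z Φ(b,c)`. -/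
theorem phi3Reg_contiguous (b : ℕ) (c : ℤ) (w z : ℝ) :
    ((b + 1 : ℕ) : ℝ) * w * phi3Reg ((b + 2 : ℕ) : ℝ) c w z =
      phi3Reg ((b + 1 : ℕ) : ℝ) ((c - 2 : ℤ) : ℝ) w z -
        ((c : ℝ) - 2) * phi3Reg ((b + 1 : ℕ) : ℝ) ((c - 1 : ℤ) : ℝ) w z -
        z * phi3Reg ((b + 1 : ℕ) : ℝ) c w z := by
  set g : ℕ → ℕ → ℝ := fun p q => (ascPochhammer ℝ p).eval ((b + 1 : ℕ) : ℝ) *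
      (Real.Gamma (((c - 1 : ℤ) : ℝ) + p + q))⁻¹ * w ^ p * z ^ q /
        ((p.factorial : ℝ) * (q.factorial : ℝ)) with hg
  have h1 : HasSum (fun p : ℕ × ℕ => (p.1 : ℝ) * g p.1 p.2)
      (((b + 1 : ℕ) : ℝ) * w * phi3Reg ((b + 2 : ℕ) : ℝ) c w z) := by
    have hinj : Function.Injective fun p : ℕ × ℕ => (p.1 + 1, p.2) := by
      rintro ⟨a, b⟩ ⟨c, d⟩ h
      simpa using h
    rw [← hinj.hasSum_iff]
    · refine ((hasSum_phi3Reg (b + 1) c w z).mul_left _).congr_term ?_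
      rintro ⟨p, q⟩
      simp only [hg, Function.comp_apply]
      rw [ascPochhammer_succ_left, Nat.factorial_succ]
      simp only [Polynomial.eval_mul, Polynomial.eval_X, Polynomial.eval_comp,
        Polynomial.eval_add, Polynomial.eval_one]
      push_cast
      rw [show (c : ℝ) - 1 + (p + 1) + q = c + p + q by ring]
      field_simp
      ring
    · rintro ⟨p, q⟩ h
      cases p with
      | zero => simp
      | succ p => exact absurd ⟨(p, q), rfl⟩ h
  have h2 : HasSum (fun p : ℕ × ℕ => (p.2 : ℝ) * g p.1 p.2)
      (z * phi3Reg ((b + 1 : ℕ) : ℝ) c w z) := by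
    have hinj : Function.Injective fun p : ℕ × ℕ => (p.1, p.2 + 1) := by
      rintro ⟨a, b⟩ ⟨c, d⟩ h
      simpa using h
    rw [← hinj.hasSum_iff]
    · refine ((hasSum_phi3Reg b c w z).mul_left _).congr_term ?_
      rintro ⟨p, q⟩
      simp only [hg, Function.comp_apply]
      rw [Nat.factorial_succ]
      push_cast
      rw [show (c : ℝ) - 1 + p + (q + 1) = c + p + q by ring]
      field_simp
      ring
    · rintro ⟨p, q⟩ h
      cases q with
      | zero => simp
      | succ q => exact absurd ⟨(p, q), rfl⟩ h
  have h3 := (hasSum_phi3Reg b (c - 2) w z).sub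
    ((hasSum_phi3Reg b (c - 1) w z).mul_left ((c : ℝ) - 2))
  rw [eq_sub_iff_add_eq]
  refine (h1.add h2).unique (h3.congr_term ?_)
  rintro ⟨p, q⟩
  have h4 := inv_Gamma_eq_mul_inv_Gamma_add_one ((c : ℝ) - 2 + p + q)
  rw [show (c : ℝ) - 2 + p + q + 1 = c - 1 + p + q by ring] at h4
  simp only [hg]
  push_cast
  rw [h4]
  ring

/-- Both sides are the sum of `w^i y^q / (i! q!)` over `i, q ≥ 0` with `q ≤ i + 1 - c`, where
`y = z / w`, taken in the two possible orders. -/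
theorem marcumSeries_eq_phi3Reg (c : ℤ) {w : ℝ} (hw : 0 < w) (z : ℝ) :
    w ^ (1 - c) * (Real.exp (w + z / w) * marcumSeries (2 - c) w (z / w)) =
      phi3Reg ((1 : ℕ) : ℝ) c w z := by
  set y := z / w with hy
  have hz : z = w * y := by
    rw [hy]
    field_simp
  set h : ℕ → ℕ → ℝ := fun i q => if (q : ℤ) ≤ i + 1 - c then
    w ^ i / (i.factorial : ℝ) * (y ^ q / (q.factorial : ℝ)) else 0 with hh
  have hsum : Summable (Function.uncurry h) := by
    refine Summable.of_norm_bounded (g := fun p : ℕ × ℕ => |w| ^ p.1 / (p.1.factorial : ℝ) *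
      (|y| ^ p.2 / (p.2.factorial : ℝ))) (Summable.mul_of_nonneg (hasSum_exp |w|).summable
      (hasSum_exp |y|).summable (fun i => by positivity) (fun i => by positivity)) ?_
    rintro ⟨i, q⟩
    simp only [Function.uncurry_apply_pair, hh]
    split_ifs
    · simp
    · rw [norm_zero]
      positivity
  have hrow : ∀ i, HasSum (fun q => h i q)
      (w ^ i / (i.factorial : ℝ) * expPartial (i + (2 - c) - 1) y) := fun i => by
    refine ((hasSum_ite_le_expPartial (i + (2 - c) - 1) y).mul_left _).congr_term fun q => ?_
    simp only [hh]
    rw [mul_ite, mul_zero, show (i : ℤ) + (2 - c) - 1 = i + 1 - c by ring]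
  have hcol : ∀ q, HasSum (fun i => h i q)
      (y ^ q / (q.factorial : ℝ) * (Real.exp w - expPartial (c - 1 + q - 1) w)) := fun q => by
    refine (((hasSum_exp w).sub
      (hasSum_ite_le_expPartial (c - 1 + q - 1) w)).mul_left _).congr_term fun i => ?_
    simp only [hh]
    by_cases h1 : (q : ℤ) ≤ i + 1 - c
    · rw [if_pos h1, if_neg (by omega), sub_zero, mul_comm]
    · rw [if_neg h1, if_pos (by omega), sub_self, mul_zero]
  have hM : Real.exp (w + y) * marcumSeries (2 - c) w y = ∑' i, ∑' q, h i q := by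
    rw [marcumSeries, ← mul_assoc, ← Real.exp_add, add_neg_cancel, Real.exp_zero, one_mul]
    exact tsum_congr fun i => (hrow i).tsum_eq.symm
  have hterm : ∀ q p : ℕ, (ascPochhammer ℝ p).eval ((0 + 1 : ℕ) : ℝ) *
      (Real.Gamma ((c : ℝ) + p + q))⁻¹ * w ^ p * z ^ q /
        ((p.factorial : ℝ) * (q.factorial : ℝ)) =
      w ^ (1 - c) * (y ^ q / (q.factorial : ℝ) * expTerm (c - 1 + q + p) w) := by
    intro q p
    have h1 := ascPochhammer_eval_succ_div_factorial 0 p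
    rw [zero_add p, Nat.choose_self] at h1
    have h2 := zpow_mul_inv_Gamma c p q w hw.ne'
    calc _ = (ascPochhammer ℝ p).eval ((0 + 1 : ℕ) : ℝ) / (p.factorial : ℝ) *
          (((Real.Gamma ((c : ℝ) + p + q))⁻¹ * w ^ p * w ^ q) * (y ^ q / (q.factorial : ℝ))) := by
          rw [hz, mul_pow]
          ring
      _ = _ := by
          rw [h1, h2]
          push_cast
          ring
  have hPhi : phi3Reg ((1 : ℕ) : ℝ) c w z = w ^ (1 - c) * ∑' q, ∑' i, h i q := by
    have h1 := hasSum_phi3Reg 0 c w z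
    have h2 := (Equiv.prodComm ℕ ℕ).hasSum_iff.2 h1
    rw [← (zero_add 1 : 0 + 1 = 1), ← h2.tsum_eq, h2.summable.tsum_prod, ← tsum_mul_left]
    refine tsum_congr fun q => ?_
    simp only [Function.comp_apply, Equiv.prodComm_apply, Prod.swap_prod_mk]
    rw [tsum_congr (hterm q), tsum_mul_left, tsum_mul_left, (hasSum_expTerm_tail _ _).tsum_eq,
      (hcol q).tsum_eq]
  rw [hM, hPhi, hsum.tsum_comm]

/-! ### Reduction of the first parameter of the hypergeometric function -/

/-- The coefficient of `A_{j+2k}` at `z^k`, up to the factor `± 1/b!`, for the first parameter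
`b + 1`. It is indexed by `j = i - 2k` and `k`, which makes its recursion in `b` uniform. -/
def falling (b j k : ℕ) (c : ℝ) : ℝ :=
  (b.descFactorial (j + k) : ℝ) * (descPochhammer ℝ j).eval (c - k - 2) /
    ((j.factorial : ℝ) * (k.factorial : ℝ))

theorem falling_eq_zero {b j k : ℕ} (h : b < j + k) (c : ℝ) : falling b j k c = 0 := by
  simp [falling, Nat.descFactorial_eq_zero_iff_lt.2 h]

theorem descFactorial_succ_left (b n : ℕ) :
    ((b + 1).descFactorial (n + 1) : ℝ) =
      (b.descFactorial (n + 1) : ℝ) + (n + 1) * (b.descFactorial n : ℝ) := by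
  have h1 := Nat.succ_descFactorial_succ b n
  have h2 := Nat.descFactorial_succ b n
  rw [h1, h2]
  push_cast
  rcases le_or_gt n b with h | h
  · rw [Nat.cast_sub h]
    ring
  · simp [Nat.descFactorial_eq_zero_iff_lt.2 h]

theorem descPochhammer_succ_eval_left (j : ℕ) (x : ℝ) :
    (descPochhammer ℝ (j + 1)).eval (x + 1) = (x + 1) * (descPochhammer ℝ j).eval x := by
  rw [descPochhammer_succ_left]
  simp

theorem descPochhammer_eval_add_one (j : ℕ) (x : ℝ) :
    (descPochhammer ℝ (j + 1)).eval (x + 1) =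
      (descPochhammer ℝ (j + 1)).eval x + (j + 1) * (descPochhammer ℝ j).eval x := by
  rw [descPochhammer_succ_eval_left, descPochhammer_succ_eval]
  ring

theorem falling_zero_zero (b : ℕ) (c : ℝ) : falling b 0 0 c = 1 := by
  simp [falling]

theorem falling_succ_zero (b j : ℕ) (c : ℝ) : falling (b + 1) (j + 1) 0 c =
    falling b (j + 1) 0 c + (c - 2) * falling b j 0 (c - 1) := by
  have h2 := descPochhammer_succ_eval_left j (c - 3)
  rw [show c - 3 + 1 = c - 2 by ring] at h2
  simp only [falling, add_zero, Nat.cast_zero, sub_zero, show c - 1 - 2 = c - 3 by ring]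
  rw [descFactorial_succ_left, h2, Nat.factorial_succ]
  push_cast
  field_simp

theorem falling_zero_succ (b k : ℕ) (c : ℝ) : falling (b + 1) 0 (k + 1) c =
    falling b 0 (k + 1) c + falling b 0 k (c - 2) := by
  simp only [falling, zero_add, descPochhammer_zero, Polynomial.eval_one]
  rw [descFactorial_succ_left, Nat.factorial_succ]
  push_cast
  field_simp

/-- The generic case of the recursion of the coefficients that mirrors `phi3Reg_contiguous`. It
rests on `(j+k) (x+1)_j = k x_j + (x+k+1) j x_{j-1}` for the falling
factorials `x_j`, at `x = c-k-3`, with `j + 1` and `k + 1` in place of `j` and `k`. -/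
theorem falling_succ_succ (b j k : ℕ) (c : ℝ) : falling (b + 1) (j + 1) (k + 1) c =
    falling b (j + 1) (k + 1) c + (c - 2) * falling b j (k + 1) (c - 1) +
      falling b (j + 1) k (c - 2) := by
  have h1 := descPochhammer_succ_eval_left j (c - k - 4)
  have h2 := descPochhammer_eval_add_one j (c - k - 4)
  rw [h1] at h2
  rw [show c - k - 4 + 1 = c - k - 3 by ring] at h1 h2
  have h3 : (descPochhammer ℝ (j + 1)).eval (c - k - 4) =
      (c - k - 3 - (j + 1)) * (descPochhammer ℝ j).eval (c - k - 4) := by linarith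
  simp only [falling]
  push_cast
  rw [show c - (k + 1) - 2 = c - k - 3 by ring, show c - 1 - (k + 1) - 2 = c - k - 4 by ring,
    show c - 2 - k - 2 = c - k - 4 by ring, show j + 1 + (k + 1) = (j + k + 1) + 1 by ring,
    descFactorial_succ_left, h1, h3, show j + (k + 1) = j + k + 1 by ring,
    show j + 1 + k = j + k + 1 by ring, Nat.factorial_succ, Nat.factorial_succ]
  push_cast
  field_simp
  ring

theorem sum_range_succ_add_shifts (N₁ N₂ : ℕ) {T T₀ T₁ T₂ : ℕ → ℕ → ℝ}
    (h00 : T 0 0 = T₀ 0 0) (h10 : ∀ j, T (j + 1) 0 = T₀ (j + 1) 0 + T₁ j 0)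
    (h01 : ∀ k, T 0 (k + 1) = T₀ 0 (k + 1) + T₂ 0 k)
    (h11 : ∀ j k, T (j + 1) (k + 1) = T₀ (j + 1) (k + 1) + T₁ j (k + 1) + T₂ (j + 1) k) :
    ∑ j ∈ Finset.range (N₁ + 1), ∑ k ∈ Finset.range (N₂ + 1), T j k =
      ∑ j ∈ Finset.range (N₁ + 1), ∑ k ∈ Finset.range (N₂ + 1), T₀ j k +
      ∑ j ∈ Finset.range N₁, ∑ k ∈ Finset.range (N₂ + 1), T₁ j k +
      ∑ j ∈ Finset.range (N₁ + 1), ∑ k ∈ Finset.range N₂, T₂ j k := by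
  simp only [Finset.sum_range_succ', h00, h10, h01, h11, Finset.sum_add_distrib]
  ring

/-- Iteration of the contiguous relation: `Φ(b+1,c)` as a finite combination of functions
`Φ(1,c-i)`. -/
theorem phi3Reg_eq_sum_falling (b : ℕ) (c : ℤ) (w : ℝ) {z : ℝ} (hz : z ≠ 0) (N₁ N₂ : ℕ)
    (h₁ : b < N₁) (h₂ : b < N₂) :
    (-1) ^ b * (b.factorial : ℝ) * w ^ b * phi3Reg ((b + 1 : ℕ) : ℝ) c w z =
      ∑ j ∈ Finset.range N₁, ∑ k ∈ Finset.range N₂, (-1) ^ k * falling b j k c *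
        (z ^ b / z ^ (j + k)) * phi3Reg ((1 : ℕ) : ℝ) ((c - j - 2 * k : ℤ) : ℝ) w z := by
  induction b generalizing c N₁ N₂ with
  | zero =>
    obtain ⟨M₁, rfl⟩ := Nat.exists_eq_add_of_lt h₁
    obtain ⟨M₂, rfl⟩ := Nat.exists_eq_add_of_lt h₂
    rw [Finset.sum_eq_single 0, Finset.sum_eq_single 0]
    · simp [falling_zero_zero]
    · intro k _ hk
      rw [falling_eq_zero (by omega)]
      ring
    · simp
    · intro j _ hj
      refine Finset.sum_eq_zero fun k _ => ?_
      rw [falling_eq_zero (by omega)]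
      ring
    · simp
  | succ b ih =>
    obtain ⟨M₁, rfl⟩ := Nat.exists_eq_add_of_lt h₁
    obtain ⟨M₂, rfl⟩ := Nat.exists_eq_add_of_lt h₂
    have hc := phi3Reg_contiguous b c w z
    have e0 := ih c (b + 1 + M₁ + 1) (b + 1 + M₂ + 1) (by omega) (by omega)
    have e1 := ih (c - 1) (b + 1 + M₁) (b + 1 + M₂ + 1) (by omega) (by omega)
    have e2 := ih (c - 2) (b + 1 + M₁ + 1) (b + 1 + M₂) (by omega) (by omega)
    have hL : (-1) ^ (b + 1) * ((b + 1).factorial : ℝ) * w ^ (b + 1) *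
        phi3Reg ((b + 1 + 1 : ℕ) : ℝ) c w z =
        z * ((-1) ^ b * (b.factorial : ℝ) * w ^ b * phi3Reg ((b + 1 : ℕ) : ℝ) c w z) +
        ((c : ℝ) - 2) * ((-1) ^ b * (b.factorial : ℝ) * w ^ b *
          phi3Reg ((b + 1 : ℕ) : ℝ) ((c - 1 : ℤ) : ℝ) w z) -
        (-1) ^ b * (b.factorial : ℝ) * w ^ b *
          phi3Reg ((b + 1 : ℕ) : ℝ) ((c - 2 : ℤ) : ℝ) w z := by
      calc _ = -((-1) ^ b * (b.factorial : ℝ) * w ^ b *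
            (((b + 1 : ℕ) : ℝ) * w * phi3Reg ((b + 2 : ℕ) : ℝ) c w z)) := by
            rw [Nat.factorial_succ]
            push_cast
            ring_nf
        _ = _ := by
            rw [hc]
            ring
    rw [hL, e0, e1, e2]
    simp only [Finset.mul_sum]
    rw [sub_eq_add_neg, ← Finset.sum_neg_distrib]
    simp only [← Finset.sum_neg_distrib]
    symm
    refine sum_range_succ_add_shifts _ _ ?_ ?_ ?_ ?_
    · simp only [falling_zero_zero]
      ring
    · intro j
      simp only [falling_succ_zero]
      rw [show c - 1 - (j : ℤ) - 2 * ((0 : ℕ) : ℤ) =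
        c - ((j + 1 : ℕ) : ℤ) - 2 * ((0 : ℕ) : ℤ) by push_cast; ring]
      push_cast
      field_simp
      ring
    · intro k
      simp only [falling_zero_succ]
      rw [show c - 2 - ((0 : ℕ) : ℤ) - 2 * (k : ℤ) =
        c - ((0 : ℕ) : ℤ) - 2 * ((k + 1 : ℕ) : ℤ) by push_cast; ring]
      push_cast
      field_simp
      ring
    · intro j k
      simp only [falling_succ_succ]
      rw [show c - 1 - (j : ℤ) - 2 * ((k + 1 : ℕ) : ℤ) =
        c - ((j + 1 : ℕ) : ℤ) - 2 * ((k + 1 : ℕ) : ℤ) by push_cast; ring,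
        show c - 2 - ((j + 1 : ℕ) : ℤ) - 2 * (k : ℤ) =
        c - ((j + 1 : ℕ) : ℤ) - 2 * ((k + 1 : ℕ) : ℤ) by push_cast; ring]
      push_cast
      field_simp
      ring

theorem aCoeff_eq_sum_falling (i b : ℕ) (c : ℤ) (z : ℝ) :
    aCoeff i (b + 1) c z = (-1) ^ b / (b.factorial : ℝ) *
      ∑ k ∈ Finset.range (i / 2 + 1), (-1) ^ k * falling b (i - 2 * k) k c * z ^ k := by
  rw [aCoeff, Nat.add_sub_cancel]
  congr 1
  refine Finset.sum_congr rfl fun k hk => ?_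
  rw [Finset.mem_range] at hk
  obtain ⟨j, rfl⟩ : ∃ j, i = j + 2 * k := ⟨i - 2 * k, by omega⟩
  rw [show j + 2 * k - k = j + k by omega, show j + 2 * k - 2 * k = j by omega, falling,
    ← descPochhammer_eval_eq_descFactorial, descPochhammer_eval_eq_ascPochhammer,
    descPochhammer_eval_eq_ascPochhammer]
  push_cast
  rw [show (b : ℝ) + 1 - (j + 2 * k) + k = b - (j + k) + 1 by ring,
    show (c : ℝ) - (j + 2 * k) - 1 + k = c - k - 2 - j + 1 by ring]
  ring

theorem phi3Reg_one_eq_phi3Closed (c : ℤ) {w z : ℝ} (hw : 0 < w) (hz : 0 ≤ z) :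
    w ^ (1 - c) * (Real.exp (w + z / w) *
      marcumQ (2 - c) (Real.sqrt (2 * w)) (Real.sqrt (2 * (z / w)))) =
        phi3Reg ((1 : ℕ) : ℝ) c w z := by
  rw [← marcumSeries_eq_phi3Reg c hw z, marcumQ_eq_marcumSeries _
    (Or.inl (Real.sqrt_pos.2 (by positivity)).ne') (Or.inr (Real.sqrt_nonneg _)),
    Real.sq_sqrt (by positivity), Real.sq_sqrt (by positivity),
    mul_div_cancel_left₀ _ two_ne_zero, mul_div_cancel_left₀ _ two_ne_zero]

theorem phi3Reg_eq_phi3Closed (b : ℕ) (c : ℤ) (w z : ℝ) (hb : 1 ≤ b) (hw : 0 < w)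
    (hz : 0 < z ∨ (b = 1 ∧ z = 0)) : phi3Reg b c w z = phi3Closed b c w z := by
  obtain ⟨b, rfl⟩ := Nat.exists_eq_add_of_le' hb
  have hz0 : 0 ≤ z := by
    rcases hz with h | ⟨_, rfl⟩
    · exact h.le
    · exact le_rfl
  have hR : phi3Closed (b + 1) c w z = (z / w) ^ b * ∑ i ∈ Finset.range (2 * b + 1),
      aCoeff i (b + 1) c z / z ^ i * phi3Reg ((1 : ℕ) : ℝ) ((c - i : ℤ) : ℝ) w z := by
    rw [phi3Closed, Nat.add_sub_cancel]
    congr 1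
    refine Finset.sum_congr rfl fun i _ => ?_
    rw [← phi3Reg_one_eq_phi3Closed (c - i) hw hz0, show 2 - (c - (i : ℤ)) = 2 - c + i by ring,
      show 1 - (c - (i : ℤ)) = -(c - i - 1) by ring, zpow_neg]
    ring
  rw [hR]
  rcases hz with hz | ⟨hb1, rfl⟩
  · have hmain := phi3Reg_eq_sum_falling b c w hz.ne' (b + 1) (b + 1) (by omega) (by omega)
    have hS : ∑ i ∈ Finset.range (2 * b + 1), aCoeff i (b + 1) c z / z ^ i *
        phi3Reg ((1 : ℕ) : ℝ) ((c - i : ℤ) : ℝ) w z = (-1) ^ b / (b.factorial : ℝ) / z ^ b *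
        ∑ k ∈ Finset.range (b + 1), ∑ j ∈ Finset.range (2 * b + 1 - 2 * k),
          (-1) ^ k * falling b j k c *
          (z ^ b / z ^ (j + k)) * phi3Reg ((1 : ℕ) : ℝ) ((c - j - 2 * k : ℤ) : ℝ) w z := by
      simp only [aCoeff_eq_sum_falling, Finset.mul_sum, Finset.sum_div, Finset.sum_mul]
      rw [Finset.sum_comm' (s' := fun k => Finset.Ico (2 * k) (2 * b + 1))
        (t' := Finset.range (b + 1))
        (by intro x y; simp only [Finset.mem_range, Finset.mem_Ico]; omega)]
      refine Finset.sum_congr rfl fun k _ => ?_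
      rw [Finset.sum_Ico_eq_sum_range]
      refine Finset.sum_congr rfl fun j _ => ?_
      rw [show 2 * k + j - 2 * k = j by omega,
        show c - ((2 * k + j : ℕ) : ℤ) = c - j - 2 * k by push_cast; ring]
      field_simp
      ring
    -- Both ranges of `j` contain `j ≤ b - k`, beyond which the coefficient vanishes.
    have hS2 : ∀ k ∈ Finset.range (b + 1), ∑ j ∈ Finset.range (2 * b + 1 - 2 * k),
          (-1) ^ k * falling b j k c * (z ^ b / z ^ (j + k)) *
            phi3Reg ((1 : ℕ) : ℝ) ((c - j - 2 * k : ℤ) : ℝ) w z =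
        ∑ j ∈ Finset.range (b + 1), (-1) ^ k * falling b j k c * (z ^ b / z ^ (j + k)) *
            phi3Reg ((1 : ℕ) : ℝ) ((c - j - 2 * k : ℤ) : ℝ) w z := by
      intro k hk
      have hsub : ∀ N, b + 1 - k ≤ N → ∑ j ∈ Finset.range (b + 1 - k),
          (-1) ^ k * falling b j k c * (z ^ b / z ^ (j + k)) *
            phi3Reg ((1 : ℕ) : ℝ) ((c - j - 2 * k : ℤ) : ℝ) w z =
          ∑ j ∈ Finset.range N, (-1) ^ k * falling b j k c * (z ^ b / z ^ (j + k)) *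
            phi3Reg ((1 : ℕ) : ℝ) ((c - j - 2 * k : ℤ) : ℝ) w z := fun N hN => by
        refine Finset.sum_subset (Finset.range_subset_range.2 hN) fun j _ hj => ?_
        rw [Finset.mem_range] at hj
        rw [falling_eq_zero (by omega)]
        ring
      rw [Finset.mem_range] at hk
      exact (hsub _ (by omega)).symm.trans (hsub _ (by omega))
    rw [hS, Finset.sum_congr rfl hS2, Finset.sum_comm, ← hmain]
    have h1 : ((-1 : ℝ) ^ b) * (-1) ^ b = 1 := by
      rw [← mul_pow]
      simp
    rw [div_pow]
    field_simp
    linear_combination (-phi3Reg ((b + 1 : ℕ) : ℝ) c w z) * h1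
  · obtain rfl : b = 0 := by omega
    simp [aCoeff]

/-! ### Negative binomial averages of exponential partial sums -/

theorem summable_multichoose_mul_pow (J : ℕ) {θ : ℝ} (hθ : |θ| < 1) :
    Summable fun s : ℕ => (J.multichoose s : ℝ) * θ ^ s := by
  cases J with
  | zero =>
    refine summable_of_ne_finset_zero (s := {0}) fun s hs => ?_
    obtain ⟨s, rfl⟩ := Nat.exists_eq_succ_of_ne_zero (by simpa using hs)
    simp
  | succ J =>
    refine (summable_choose_mul_geometric_of_norm_lt_one J (r := θ) hθ).congr fun s => ?_
    rw [Nat.multichoose_eq, show J + 1 + s - 1 = s + J by omega,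
      ← Nat.choose_symm_add (a := s) (b := J)]

theorem summable_multichoose_mul {J : ℕ} {θ : ℝ} (hθ : |θ| < 1) {a : ℕ → ℝ} {C : ℝ}
    (ha : ∀ s, |a s| ≤ C) : Summable fun s : ℕ => (J.multichoose s : ℝ) * θ ^ s * a s := by
  refine Summable.of_norm_bounded ((summable_multichoose_mul_pow J (θ := |θ|)
    (by rwa [abs_abs])).mul_right C) fun s => ?_
  rw [norm_mul, norm_mul, norm_pow]
  simp only [Real.norm_eq_abs, Nat.abs_cast]
  exact mul_le_mul_of_nonneg_left (ha s) (by positivity)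

/-- A bound uniform in the integer index, which also holds for negative `y`. -/
theorem abs_expTerm_le (n : ℤ) (y : ℝ) : |expTerm n y| ≤ 2 * Real.exp |y| := by
  have h := expPartial_eq_add_expTerm n y
  have h1 := abs_expPartial_le n y
  have h2 := abs_expPartial_le (n - 1) y
  rw [show expTerm n y = expPartial n y - expPartial (n - 1) y by linarith]
  exact (abs_sub _ _).trans (by linarith)

/-- `∑_s C(J+s-1, s) θ^s E_{A+J+s}(y)` for the partial sums `E` of the exponential series. -/
def negBinomPartial (θ : ℝ) (J : ℕ) (A : ℤ) (y : ℝ) : ℝ :=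
  ∑' s : ℕ, (J.multichoose s : ℝ) * θ ^ s * expPartial (A + J + s) y

/-- `∑_p C(l+p-1, p) θ^p y^{A+l+p} / (A+l+p)!`. -/
def negBinomTerm (θ : ℝ) (l : ℕ) (A : ℤ) (y : ℝ) : ℝ :=
  ∑' p : ℕ, (l.multichoose p : ℝ) * θ ^ p * expTerm (A + l + p) y

/-- The recursion in `J`, by Pascal's rule for `C(J+s-1,s)` and summation by parts. -/
theorem one_sub_mul_negBinomPartial {θ : ℝ} (hθ : |θ| < 1) (J : ℕ) (A : ℤ) (y : ℝ) :
    (1 - θ) * negBinomPartial θ (J + 1) A y =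
      negBinomPartial θ J A y + negBinomTerm θ (J + 1) A y := by
  have hE : ∀ (B : ℤ) (s : ℕ), |expPartial (B + s) y| ≤ Real.exp |y| := fun B s =>
    abs_expPartial_le _ _
  have hX := (summable_multichoose_mul (J := J + 1) hθ (hE (A + (J + 1 : ℕ)))).hasSum
  have hX0 := (summable_multichoose_mul (J := J) hθ (hE (A + J))).hasSum
  have hP := (summable_multichoose_mul (J := J + 1) hθ (hE (A + J))).hasSum
  have hR := (summable_multichoose_mul (J := J + 1) hθ (a := fun s : ℕ =>
    expTerm (A + (J + 1 : ℕ) + s) y) (fun s => abs_expTerm_le _ _)).hasSum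
  have h1 := (hX.sub hR).congr_term (g := fun s : ℕ =>
      ((J + 1).multichoose s : ℝ) * θ ^ s * expPartial (A + J + s) y) fun s => by
    rw [expPartial_eq_add_expTerm (A + (J + 1 : ℕ) + s),
      show A + ((J + 1 : ℕ) : ℤ) + s - 1 = A + J + s by push_cast; ring]
    ring
  have h2 := ((hasSum_nat_add_iff' 1).2 hP).sub ((hasSum_nat_add_iff' 1).2 hX0)
  have h3 := h2.unique ((hX.mul_left θ).congr_term fun s => by
    rw [Nat.multichoose_succ_succ]
    push_cast
    rw [show A + (J : ℤ) + (s + 1) = A + (J + 1) + s by ring]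
    ring)
  have h4 := h1.unique hP
  simp only [Finset.sum_range_one, Nat.multichoose_zero_right] at h3
  rw [negBinomPartial, negBinomPartial, negBinomTerm]
  linarith

theorem negBinomPartial_zero (θ : ℝ) (A : ℤ) (y : ℝ) :
    negBinomPartial θ 0 A y = expPartial A y := by
  rw [negBinomPartial, tsum_eq_single 0]
  · simp
  · intro s hs
    obtain ⟨s, rfl⟩ := Nat.exists_eq_succ_of_ne_zero hs
    simp

theorem negBinomPartial_eq_sum {θ : ℝ} (hθ : |θ| < 1) (J : ℕ) (A : ℤ) (y : ℝ) :
    negBinomPartial θ J A y = (1 - θ) ^ (-(J : ℤ)) * expPartial A y +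
      ∑ l ∈ Finset.range J, (1 - θ) ^ ((l : ℤ) - J) * negBinomTerm θ (l + 1) A y := by
  have h0 : 1 - θ ≠ 0 := by
    have := (abs_lt.1 hθ).2
    linarith
  induction J with
  | zero => simp [negBinomPartial_zero]
  | succ J ih =>
    have h1 := one_sub_mul_negBinomPartial hθ J A y
    have h2 : ∀ e : ℤ, (1 - θ) ^ (e - 1) = (1 - θ)⁻¹ * (1 - θ) ^ e := fun e => by
      rw [zpow_sub_one₀ h0, mul_comm]
    have h3 : negBinomPartial θ (J + 1) A y =
        (1 - θ)⁻¹ * (negBinomPartial θ J A y + negBinomTerm θ (J + 1) A y) := by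
      rw [← h1]
      field_simp
    rw [h3, ih, Finset.sum_range_succ]
    push_cast
    rw [show -((J : ℤ) + 1) = -J - 1 by ring, h2, show (J : ℤ) - (J + 1) = -1 by ring, zpow_neg_one]
    simp only [show ∀ l : ℕ, (l : ℤ) - (J + 1) = l - J - 1 by intro l; ring, h2, mul_assoc]
    rw [← Finset.mul_sum]
    ring

/-- The series of `Φ(l, N+l; t y, x y)`, summed over the first index. -/
theorem hasSum_phi3Reg_rows (l : ℕ) (N : ℤ) {y : ℝ} (hy : y ≠ 0) (t x : ℝ) :
    HasSum (fun q : ℕ => x ^ q / (q.factorial : ℝ) *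
        negBinomTerm t (l + 1) (N + q - 1) y)
      (y ^ (N + ((l + 1 : ℕ) : ℤ) - 1) * phi3Reg ((l + 1 : ℕ) : ℝ) ((N + ((l + 1 : ℕ) : ℤ) : ℤ) : ℝ)
        (t * y) (x * y)) := by
  have h1 := hasSum_phi3Reg l (N + ((l + 1 : ℕ) : ℤ)) (t * y) (x * y)
  have h2 := ((Equiv.prodComm ℕ ℕ).hasSum_iff.2 h1).mul_left (y ^ (N + ((l + 1 : ℕ) : ℤ) - 1))
  refine (h2.prod_fiberwise fun q => (h2.summable.prod_factor q).hasSum).congr_term fun q => ?_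
  rw [negBinomTerm, ← tsum_mul_left]
  refine tsum_congr fun p => ?_
  simp only [Function.comp_apply, Equiv.prodComm_apply, Prod.swap_prod_mk]
  have h3 := ascPochhammer_eval_succ_div_factorial l p
  have h4 := zpow_mul_inv_Gamma (N + ((l + 1 : ℕ) : ℤ)) p q y hy
  have h5 : y ^ (N + ((l + 1 : ℕ) : ℤ) - 1) * y ^ (1 - (N + ((l + 1 : ℕ) : ℤ))) = 1 := by
    rw [← zpow_add₀ hy]
    simp
  rw [Nat.multichoose_eq, show l + 1 + p - 1 = l + p by omega, ← h3,
    show N + q - 1 + ((l + 1 : ℕ) : ℤ) + p = N + ((l + 1 : ℕ) : ℤ) - 1 + q + p by ring]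
  symm
  calc _ = y ^ (N + ((l + 1 : ℕ) : ℤ) - 1) *
        ((Real.Gamma (((N + ((l + 1 : ℕ) : ℤ) : ℤ) : ℝ) + p + q))⁻¹ * y ^ p * y ^ q) *
        (x ^ q / (q.factorial : ℝ) *
        ((ascPochhammer ℝ p).eval ((l + 1 : ℕ) : ℝ) / (p.factorial : ℝ) * t ^ p)) := by
        rw [mul_pow, mul_pow]
        ring
    _ = (y ^ (N + ((l + 1 : ℕ) : ℤ) - 1) * y ^ (1 - (N + ((l + 1 : ℕ) : ℤ)))) *
        (x ^ q / (q.factorial : ℝ) *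
        ((ascPochhammer ℝ p).eval ((l + 1 : ℕ) : ℝ) / (p.factorial : ℝ) * t ^ p *
          expTerm (N + ((l + 1 : ℕ) : ℤ) - 1 + q + p) y)) := by
        rw [h4]
        ring
    _ = _ := by rw [h5, one_mul]

/-- The series hidden in `I_{m,n,k}`: a Poisson sum of negative binomial averages. -/
theorem hasSum_iForm {θ : ℝ} (hθ : |θ| < 1) {β : ℝ} (hβ : β ≠ 0) (m n k : ℕ) (hk : k ≤ n)
    (δ u : ℝ) :
    HasSum (fun q : ℕ => (δ * θ * u ^ 2) ^ q / (q.factorial : ℝ) *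
        negBinomPartial θ (n - k) ((k : ℤ) + m - n + q - 1) (β ^ 2 / 2))
      (iForm (fun b c => phi3Reg b c) m n k β δ θ u) := by
  set y := β ^ 2 / 2 with hy
  have hy0 : y ≠ 0 := by positivity
  set x := δ * θ * u ^ 2 with hx
  set N : ℤ := (k : ℤ) + m - n with hN
  have hxy : δ * θ * u ^ 2 * β ^ 2 / 2 = x * y := by
    rw [hx, hy]
    ring
  have h0 := (hasSum_exp x).mul_left ((1 - θ) ^ ((k : ℤ) - n) * Real.exp y)
  have h1 := (hasSum_phi3Reg_rows 0 N hy0 1 x).mul_left ((1 - θ) ^ ((k : ℤ) - n))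
  have h2 : ∀ l ∈ Finset.range (n - k), _ := fun l _ =>
    (hasSum_phi3Reg_rows l N hy0 θ x).mul_left ((1 - θ) ^ ((k : ℤ) + ((l + 1 : ℕ) : ℤ) - n - 1))
  have h3 := (h0.sub h1).add (hasSum_sum h2)
  have hI : iForm (fun b c => phi3Reg b c) m n k β δ θ u =
      (1 - θ) ^ ((k : ℤ) - n) * Real.exp y * Real.exp x -
      (1 - θ) ^ ((k : ℤ) - n) * (y ^ (N + ((0 + 1 : ℕ) : ℤ) - 1) *
        phi3Reg ((0 + 1 : ℕ) : ℝ) ((N + ((0 + 1 : ℕ) : ℤ) : ℤ) : ℝ) (1 * y) (x * y)) +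
      ∑ l ∈ Finset.range (n - k), (1 - θ) ^ ((k : ℤ) + ((l + 1 : ℕ) : ℤ) - n - 1) *
        (y ^ (N + ((l + 1 : ℕ) : ℤ) - 1) *
        phi3Reg ((l + 1 : ℕ) : ℝ) ((N + ((l + 1 : ℕ) : ℤ) : ℤ) : ℝ) (θ * y) (x * y)) := by
    rw [iForm, sum_Icc_one, hxy, ← hx, ← hy, ← hN]
    simp only [zero_add, one_mul, Nat.cast_one, add_sub_cancel_right, mul_assoc]
  rw [hI]
  refine h3.congr_term fun q => ?_
  have h4 : negBinomTerm 1 (0 + 1) (N + q - 1) y = Real.exp y - expPartial (N + q - 1) y := by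
    have := hasSum_expTerm_tail (N + q) y
    rw [← this.tsum_eq, negBinomTerm]
    refine tsum_congr fun p => ?_
    rw [Nat.multichoose_eq, show 0 + 1 + p - 1 = p by omega, Nat.choose_self]
    rw [one_pow, show N + (q : ℤ) - 1 + ((0 + 1 : ℕ) : ℤ) + p = N + q + p by push_cast; ring]
    simp
  rw [h4, negBinomPartial_eq_sum hθ, Nat.cast_sub hk, show -((n : ℤ) - k) = k - n by ring]
  simp only [show ∀ l : ℕ, (l : ℤ) - (n - k) = k + ((l + 1 : ℕ) : ℤ) - n - 1 by
    intro l; push_cast; ring]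
  rw [mul_add, Finset.mul_sum]
  congr 1
  · ring
  · exact Finset.sum_congr rfl fun l _ => by ring

/-- Vandermonde's identity in the form that collects the powers of `v` in the sum over `k`. -/
theorem sum_multichoose_antidiagonal (n S : ℕ) (v : ℝ) :
    ∑ k ∈ Finset.range (n + 1), v ^ k / (k.factorial : ℝ) *
      ∑ p ∈ Finset.HasAntidiagonal.antidiagonal S, v ^ p.1 / (p.1.factorial : ℝ) *
        ((n + 1 - k).multichoose p.2 : ℝ) =
    ((n + S).choose S : ℝ) * expPartial ((S + n : ℕ) : ℤ) v := by
  have hrow : ∀ p ∈ Finset.HasAntidiagonal.antidiagonal S,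
      ∑ k ∈ Finset.range (n + 1), v ^ k / (k.factorial : ℝ) * (v ^ p.1 / (p.1.factorial : ℝ) *
        ((n + 1 - k).multichoose p.2 : ℝ)) =
      ∑ t ∈ Finset.range (S + n + 1), v ^ t / (t.factorial : ℝ) *
        ((t.choose p.1 : ℝ) * ((S + n - t).choose p.2 : ℝ)) := by
    rintro ⟨q, s⟩ hp
    rw [Finset.HasAntidiagonal.mem_antidiagonal] at hp
    simp only at hp ⊢
    have hsub : Finset.Ico q (q + (n + 1)) ⊆ Finset.range (S + n + 1) := by
      intro t
      simp only [Finset.mem_Ico, Finset.mem_range]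
      omega
    rw [← Finset.sum_subset hsub, Finset.sum_Ico_eq_sum_range, Nat.add_sub_cancel_left]
    · refine Finset.sum_congr rfl fun k hk => ?_
      rw [Finset.mem_range] at hk
      have h1 := Nat.choose_mul_factorial_mul_factorial (show q ≤ q + k by omega)
      rw [Nat.add_sub_cancel_left] at h1
      have h2 : ((q + k).factorial : ℝ) = ((q + k).choose q : ℝ) * q.factorial * k.factorial := by
        exact_mod_cast h1.symm
      have h3 : ((q + k).choose q : ℝ) ≠ 0 := by
        exact_mod_cast (Nat.choose_pos (by omega)).ne'
      rw [Nat.multichoose_eq, show n + 1 - k + s - 1 = S + n - (q + k) by omega, h2]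
      field_simp
      ring
    · intro t ht ht'
      simp only [Finset.mem_Ico, Finset.mem_range] at ht ht'
      rcases lt_or_ge t q with h | h
      · simp [Nat.choose_eq_zero_of_lt h]
      · simp [Nat.choose_eq_zero_of_lt (show S + n - t < s by omega)]
  simp only [Finset.mul_sum]
  rw [Finset.sum_comm, Finset.sum_congr rfl hrow, Finset.sum_comm, expPartial_natCast,
    Finset.mul_sum]
  refine Finset.sum_congr rfl fun t ht => ?_
  rw [Finset.mem_range] at ht
  rw [← Finset.mul_sum, mul_comm]
  congr 1
  have := Nat.add_choose_eq t (S + n - t) S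
  rw [show t + (S + n - t) = n + S by omega] at this
  rw [this]
  push_cast
  rfl

theorem HasSum.antidiagonal {f : ℕ × ℕ → ℝ} {S : ℝ} (h : HasSum f S) :
    HasSum (fun n => ∑ p ∈ Finset.HasAntidiagonal.antidiagonal n, f p) S := by
  have h1 := Finset.HasAntidiagonal.sigmaAntidiagonalEquivProd.hasSum_iff.2 h
  refine (h1.sigma fun n => hasSum_fintype _).congr_term fun n => ?_
  exact (Finset.sum_coe_sort (Finset.HasAntidiagonal.antidiagonal n) f).symm

/-- The sum over `k` in the formula for `K_{m,n}(u)`, as a single series. -/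
theorem hasSum_sum_iForm {θ : ℝ} (hθ : |θ| < 1) {β : ℝ} (hβ : β ≠ 0) (m n : ℕ) (δ u : ℝ) :
    HasSum (fun S : ℕ => ((n + S).choose S : ℝ) * θ ^ S * expPartial (S + m - 1) (β ^ 2 / 2) *
        expPartial ((S + n : ℕ) : ℤ) (δ * u ^ 2))
      (∑ k ∈ Finset.range (n + 1), (δ * u ^ 2) ^ k / (k.factorial : ℝ) *
        iForm (fun b c => phi3Reg b c) m (n + 1) k β δ θ u) := by
  set y := β ^ 2 / 2 with hy
  have hk : ∀ k ∈ Finset.range (n + 1), HasSum (fun S : ℕ => (δ * u ^ 2) ^ k / (k.factorial : ℝ) *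
      ∑ p ∈ Finset.HasAntidiagonal.antidiagonal S, (δ * θ * u ^ 2) ^ p.1 / (p.1.factorial : ℝ) *
        (((n + 1 - k).multichoose p.2 : ℝ) * θ ^ p.2 * expPartial (p.1 + p.2 + m - 1) y))
      ((δ * u ^ 2) ^ k / (k.factorial : ℝ) *
        iForm (fun b c => phi3Reg b c) m (n + 1) k β δ θ u) := by
    intro k hk
    rw [Finset.mem_range] at hk
    refine HasSum.mul_left _ (HasSum.antidiagonal (f := fun p : ℕ × ℕ =>
      (δ * θ * u ^ 2) ^ p.1 / (p.1.factorial : ℝ) *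
      (((n + 1 - k).multichoose p.2 : ℝ) * θ ^ p.2 * expPartial (p.1 + p.2 + m - 1) y)) ?_)
    have hs : Summable fun p : ℕ × ℕ => (δ * θ * u ^ 2) ^ p.1 / (p.1.factorial : ℝ) *
      (((n + 1 - k).multichoose p.2 : ℝ) * θ ^ p.2 * expPartial (p.1 + p.2 + m - 1) y) := by
      refine Summable.of_norm_bounded ((Summable.mul_of_nonneg
        (hasSum_exp |δ * θ * u ^ 2|).summable
        ((summable_multichoose_mul_pow (n + 1 - k) (θ := |θ|)
          (by rwa [abs_abs])).mul_right (Real.exp |y|))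
        (fun i => by positivity) (fun i => by positivity))) ?_
      rintro ⟨q, s⟩
      simp only [norm_mul, norm_div, norm_pow, Real.norm_eq_abs, Nat.abs_cast]
      have h := abs_expPartial_le (q + s + m - 1) y
      have h2 : |δ| * |θ| * |u| ^ 2 = |δ * θ * u ^ 2| := by simp [abs_mul]
      rw [h2]
      gcongr
    have h1 := hasSum_iForm hθ hβ m (n + 1) k (by omega) δ u
    have h2 := hs.hasSum
    have h3 := h2.prod_fiberwise fun q => (hs.prod_factor q).hasSum
    rw [h1.unique (h3.congr_term fun q => ?_)]
    · exact h2
    · rw [negBinomPartial, ← tsum_mul_left]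
      refine tsum_congr fun s => ?_
      rw [Nat.cast_sub hk.le]
      congr 3
      ring
  refine (hasSum_sum hk).congr_term fun S => ?_
  have h := sum_multichoose_antidiagonal n S (δ * u ^ 2)
  calc _ = θ ^ S * expPartial (S + m - 1) y *
        (((n + S).choose S : ℝ) * expPartial ((S + n : ℕ) : ℤ) (δ * u ^ 2)) := by ring
    _ = _ := by
      rw [← h, Finset.mul_sum]
      refine Finset.sum_congr rfl fun k _ => ?_
      rw [mul_left_comm, Finset.mul_sum]
      congr 1
      refine Finset.sum_congr rfl fun p hp => ?_
      rw [Finset.HasAntidiagonal.mem_antidiagonal] at hp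
      rw [← hp]
      push_cast
      rw [show δ * θ * u ^ 2 = θ * (δ * u ^ 2) by ring, mul_pow θ (δ * u ^ 2), pow_add]
      ring

/-! ### The incomplete integral of the Marcum function -/

theorem deltaPar_pos {α : ℝ} (hα : 0 < α) (γ : ℝ) : 0 < deltaPar α γ := by
  unfold deltaPar
  positivity

theorem thetaPar_eq {α : ℝ} (hα : 0 < α) (γ : ℝ) :
    thetaPar α γ = γ ^ 2 / 2 / deltaPar α γ := by
  have := deltaPar_pos hα γ
  have h2 : 0 < γ ^ 2 + 2 * α := by positivity
  unfold thetaPar deltaPar at *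
  field_simp
  ring

theorem abs_thetaPar_lt_one {α : ℝ} (hα : 0 < α) (γ : ℝ) : |thetaPar α γ| < 1 := by
  have h2 : 0 < γ ^ 2 + 2 * α := by positivity
  rw [thetaPar, abs_of_nonneg (by positivity), div_lt_one h2]
  linarith

theorem integrable_of_abs_le_pow_mul_gaussian {α : ℝ} (hα : 0 < α) (N : ℕ) {f : ℝ → ℝ}
    (hf : Continuous f) (hle : ∀ z, |f z| ≤ |z ^ N * Real.exp (-α * z ^ 2)|) : Integrable f :=
  (integrable_pow_mul_gaussian hα N).mono hf.aestronglyMeasurable (ae_of_all _ hle)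

/-- The integrand of the incomplete integral of the Marcum function, with the Marcum function
replaced by its series; it differs from `kIntegrand` at most where `γ z = 0`. -/
def kSeriesIntegrand (m n : ℕ) (α β γ z : ℝ) : ℝ :=
  z ^ (2 * n - 1) * Real.exp (-α * z ^ 2) * marcumSeries m ((γ * z) ^ 2 / 2) (β ^ 2 / 2)

theorem kIntegrand_eq_kSeriesIntegrand {m : ℕ} (hm : 1 ≤ m) (n : ℕ) (α β : ℝ) {γ z : ℝ}
    (h : γ * z ≠ 0 ∨ m = 1) : kIntegrand m n α β γ z = kSeriesIntegrand m n α β γ z := by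
  rw [kIntegrand, kSeriesIntegrand,
    marcumQ_eq_marcumSeries _ (h.imp id fun h => by exact_mod_cast h)
      (Or.inl (by exact_mod_cast hm))]

theorem abs_kSeriesIntegrand_le (m n : ℕ) (α β γ z : ℝ) :
    |kSeriesIntegrand m n α β γ z| ≤ |z ^ (2 * n - 1) * Real.exp (-α * z ^ 2)| := by
  have hw : 0 ≤ (γ * z) ^ 2 / 2 := by positivity
  have hy : 0 ≤ β ^ 2 / 2 := by positivity
  rw [kSeriesIntegrand, abs_mul, abs_of_nonneg (marcumSeries_nonneg _ hw hy)]
  exact mul_le_of_le_one_right (abs_nonneg _) (marcumSeries_le_one _ hw hy)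

theorem continuous_kSeriesIntegrand (m n : ℕ) (α : ℝ) :
    Continuous fun p : (ℝ × ℝ × ℝ) × ℝ => kSeriesIntegrand m n α p.1.1 p.1.2.1 p.2 := by
  unfold kSeriesIntegrand
  refine Continuous.mul (by fun_prop) ?_
  exact (continuous_marcumSeries m).comp
    (f := fun p : (ℝ × ℝ × ℝ) × ℝ => ((p.1.2.1 * p.2) ^ 2 / 2, p.1.1 ^ 2 / 2)) (by fun_prop)

theorem integrable_kSeriesIntegrand (m n : ℕ) {α : ℝ} (hα : 0 < α) (β γ : ℝ) :
    Integrable (kSeriesIntegrand m n α β γ) :=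
  integrable_of_abs_le_pow_mul_gaussian hα _
    ((continuous_kSeriesIntegrand m n α).comp
      (f := fun z : ℝ => ((β, γ, (0 : ℝ)), z)) (by fun_prop))
    (abs_kSeriesIntegrand_le m n α β γ)

/-- For `γ = 0` and `m ≠ 1` the Marcum function is the junk value `0`, so this case is excluded. -/
theorem kIntegrand_eqOn {m : ℕ} (hm : 1 ≤ m) (n : ℕ) (α β : ℝ) {γ u : ℝ} (hu : 0 ≤ u)
    (h : γ ≠ 0 ∨ m = 1) :
    Set.EqOn (kIntegrand m n α β γ) (kSeriesIntegrand m n α β γ) (Set.Ioi u) := fun _ hz =>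
  kIntegrand_eq_kSeriesIntegrand hm n α β
    (h.imp (fun h => mul_ne_zero h (lt_of_le_of_lt hu hz).ne') id)

theorem integrableOn_kIntegrand {m : ℕ} (hm : 1 ≤ m) (n : ℕ) {α : ℝ} (hα : 0 < α) (β : ℝ)
    {γ u : ℝ} (hu : 0 ≤ u) (h : γ ≠ 0 ∨ m = 1) :
    IntegrableOn (kIntegrand m n α β γ) (Set.Ioi u) :=
  (integrableOn_congr_fun (kIntegrand_eqOn hm n α β hu h) measurableSet_Ioi).2
    (integrable_kSeriesIntegrand m n hα β γ).integrableOn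

theorem kIntegral_eq {m : ℕ} (hm : 1 ≤ m) (n : ℕ) (α β : ℝ) {γ u : ℝ} (hu : 0 ≤ u)
    (h : γ ≠ 0 ∨ m = 1) :
    kIntegral m n α β γ u = ∫ z in Set.Ioi u, kSeriesIntegrand m n α β γ z :=
  setIntegral_congr_fun measurableSet_Ioi (kIntegrand_eqOn hm n α β hu h)

theorem hasSum_integral_kSeriesIntegrand (m n : ℕ) {α : ℝ} (hα : 0 < α) (β γ u : ℝ) :
    HasSum (fun S : ℕ => ((deltaPar α γ) ^ (n + 1))⁻¹ / 2 * (n.factorial : ℝ) *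
        Real.exp (-β ^ 2 / 2) * Real.exp (-u ^ 2 * deltaPar α γ) *
        (((n + S).choose S : ℝ) * thetaPar α γ ^ S * expPartial (S + m - 1) (β ^ 2 / 2) *
          expPartial ((S + n : ℕ) : ℤ) (deltaPar α γ * u ^ 2)))
      (∫ z in Set.Ioi u, kSeriesIntegrand m (n + 1) α β γ z) := by
  set δ := deltaPar α γ with hδ
  set y := β ^ 2 / 2 with hy
  have hδ0 : 0 < δ := deltaPar_pos hα γ
  have hfac : ∀ r : ℕ, ((r + n).factorial : ℝ) =
      ((n + r).choose r : ℝ) * r.factorial * n.factorial := fun r => by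
    have := Nat.choose_mul_factorial_mul_factorial (show r ≤ n + r by omega)
    rw [Nat.add_sub_cancel, add_comm n r] at this
    rw [add_comm n r]
    exact_mod_cast this.symm
  have key := hasSum_integral_odd_series hδ0 n
    (fun s => Real.exp (-y) * ((γ ^ 2 / 2) ^ s / (s.factorial : ℝ) * expPartial (s + m - 1) y)) ?_ u
  · have h1 : ∫ z in Set.Ioi u, kSeriesIntegrand m (n + 1) α β γ z =
        ∫ x in Set.Ioi u, ∑' s : ℕ, Real.exp (-y) *
          ((γ ^ 2 / 2) ^ s / (s.factorial : ℝ) * expPartial (s + m - 1) y) *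
          (x ^ (2 * (s + n) + 1) * Real.exp (-δ * x ^ 2)) := by
      refine integral_congr_ae (ae_of_all _ fun x => ?_)
      simp only
      rw [kSeriesIntegrand, ← (hasSum_marcumSeries m _ _).tsum_eq, ← tsum_mul_left]
      refine tsum_congr fun s => ?_
      rw [show 2 * (n + 1) - 1 = 2 * n + 1 by omega,
        show 2 * (s + n) + 1 = (2 * n + 1) + 2 * s by ring, pow_add x (2 * n + 1), pow_mul x 2 s,
        show (γ * x) ^ 2 / 2 = (γ ^ 2 / 2) * x ^ 2 by ring, mul_pow (γ ^ 2 / 2),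
        show -δ * x ^ 2 = -α * x ^ 2 + -(γ ^ 2 / 2 * x ^ 2) by rw [hδ, deltaPar]; ring,
        neg_add, Real.exp_add, Real.exp_add]
      ring
    rw [h1]
    refine key.congr_term fun S => ?_
    rw [thetaPar_eq hα, ← hδ, hfac, div_pow (γ ^ 2 / 2) δ,
      show -β ^ 2 / 2 = -y by rw [hy]; ring, show -u ^ 2 * δ = -(δ * u ^ 2) by ring,
      show S + n + 1 = S + (n + 1) by ring, pow_add δ S]
    field_simp
  · refine ((summable_multichoose_mul (J := n + 1) (abs_thetaPar_lt_one hα γ)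
      (a := fun s => |expPartial (s + m - 1) y|) (C := Real.exp |y|) (fun s => by
        rw [abs_abs]
        exact abs_expPartial_le _ _)).mul_left (Real.exp (-y) * n.factorial)).congr fun s => ?_
    rw [hfac, Nat.multichoose_eq, show n + 1 + s - 1 = n + s by omega, thetaPar_eq hα, ← hδ,
      div_pow (γ ^ 2 / 2) δ, abs_mul, abs_mul, Real.abs_exp,
      abs_of_nonneg (show (0 : ℝ) ≤ (γ ^ 2 / 2) ^ s / (s.factorial : ℝ) by positivity)]
    field_simp

theorem kIntegral_eq_kForm {m n : ℕ} (hm : 1 ≤ m) (hn : 1 ≤ n) {α β γ u : ℝ} (hα : 0 < α)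
    (hβ : β ≠ 0) (hγ : γ ≠ 0) (hu : 0 ≤ u) :
    kIntegral m n α β γ u = kForm (fun b c => phi3Reg b c) m n α β γ u := by
  obtain ⟨n, rfl⟩ := Nat.exists_eq_add_of_le' hn
  rw [kIntegral_eq hm _ _ _ hu (Or.inl hγ), kForm, Nat.add_sub_cancel]
  exact (hasSum_integral_kSeriesIntegrand m n hα β γ u).unique
    ((hasSum_sum_iForm (abs_thetaPar_lt_one hα γ) hβ m n _ u).mul_left _)

/-! ### The incomplete integral of the Nuttall function -/

/-- The integrand that a Bessel term of the Nuttall function contributes to the incomplete integral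
of the Nuttall function. -/
def besselIntegrand (n N : ℕ) (α β γ z : ℝ) : ℝ :=
  z ^ N * Real.exp (-(β ^ 2 / 2) - deltaPar α γ * z ^ 2) * besselI n (γ * z * β)

theorem abs_besselIntegrand_le (n N : ℕ) (α β γ z : ℝ) :
    |besselIntegrand n N α β γ z| ≤ |z ^ N * Real.exp (-α * z ^ 2)| := by
  rw [besselIntegrand, abs_mul, abs_mul, abs_mul, mul_assoc, Real.abs_exp, Real.abs_exp]
  refine mul_le_mul_of_nonneg_left ?_ (abs_nonneg _)
  refine (mul_le_mul_of_nonneg_left (abs_besselI_le n _) (Real.exp_pos _).le).trans ?_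
  rw [← Real.exp_add, Real.exp_le_exp, abs_mul, deltaPar]
  -- The exponent is `-α z² - (|γ z| - |β|)² / 2`.
  have h1 : |γ * z| ^ 2 = γ ^ 2 * z ^ 2 := by rw [sq_abs, mul_pow]
  have h2 := sq_abs β
  linarith [sq_nonneg (|γ * z| - |β|)]

theorem continuous_besselIntegrand (n N : ℕ) (α : ℝ) :
    Continuous fun p : (ℝ × ℝ × ℝ) × ℝ => besselIntegrand n N α p.1.1 p.1.2.1 p.2 := by
  unfold besselIntegrand deltaPar
  exact Continuous.mul (by fun_prop) ((continuous_besselI n).comp (by fun_prop))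

theorem integrable_besselIntegrand (n N : ℕ) {α : ℝ} (hα : 0 < α) (β γ : ℝ) :
    Integrable (besselIntegrand n N α β γ) :=
  integrable_of_abs_le_pow_mul_gaussian hα _
    ((continuous_besselIntegrand n N α).comp
      (f := fun z : ℝ => ((β, γ, (0 : ℝ)), z)) (by fun_prop))
    (abs_besselIntegrand_le n N α β γ)

/-- The substitution `x = z √(2δ)`. -/
theorem integral_besselIntegrand (n i : ℕ) {α : ℝ} (hα : 0 < α) (β γ u : ℝ) :
    ∫ z in Set.Ioi u, besselIntegrand n (2 * i + n + 1) α β γ z =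
      Real.exp (-β ^ 2 / 2 * (1 - γ ^ 2 / (2 * deltaPar α γ))) *
        (1 / Real.sqrt (2 * deltaPar α γ) ^ (2 * (i + 1) + n)) *
        nuttallQ (2 * i + n + 1) n (γ * β / Real.sqrt (2 * deltaPar α γ))
          (u * Real.sqrt (2 * deltaPar α γ)) := by
  set δ := deltaPar α γ with hδ
  have hδ0 : 0 < δ := deltaPar_pos hα γ
  set s := Real.sqrt (2 * δ) with hs
  have hs0 : 0 < s := Real.sqrt_pos.2 (by positivity)
  have hs2 : s ^ 2 = 2 * δ := Real.sq_sqrt (by positivity)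
  have h1 := integral_comp_mul_right_Ioi (fun x : ℝ => x ^ (2 * i + n + 1) *
    Real.exp (-(x ^ 2 + (γ * β / s) ^ 2) / 2) * besselI n (γ * β / s * x)) u hs0
  rw [smul_eq_mul] at h1
  have h2 : nuttallQ (2 * i + n + 1) n (γ * β / s) (u * s) = s * ∫ x in Set.Ioi u,
      (x * s) ^ (2 * i + n + 1) * Real.exp (-((x * s) ^ 2 + (γ * β / s) ^ 2) / 2) *
        besselI n (γ * β / s * (x * s)) := by
    rw [h1, nuttallQ, mul_inv_cancel_left₀ hs0.ne']
  rw [h2, ← mul_assoc, ← integral_const_mul]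
  refine integral_congr_ae (ae_of_all _ fun x => ?_)
  simp only
  rw [besselIntegrand, ← hδ, show γ * β / s * (x * s) = γ * x * β by field_simp,
    show -(β ^ 2 / 2) - δ * x ^ 2 = -β ^ 2 / 2 * (1 - γ ^ 2 / (2 * δ)) +
      -((x * s) ^ 2 + (γ * β / s) ^ 2) / 2 by
        rw [mul_pow x s, div_pow, hs2]
        field_simp
        ring, Real.exp_add, mul_pow x s (2 * i + n + 1),
    show 2 * (i + 1) + n = (2 * i + n + 1) + 1 by ring,
    pow_succ s (2 * i + n + 1)]
  field_simp

/-- The series form of the Nuttall function at `(γ z, β)`, multiplied out. It holds for all `z` and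
all `γ`, including zero. -/
theorem iinqIntegrand_eq_sum (k c i : ℕ) (α β γ z : ℝ) :
    iinqIntegrand k c (i + 1) α β γ z =
      ∑ l ∈ Finset.range c, pCoeff c (l + 1) k (β ^ 2) * (γ ^ l * β ^ (k + l + 2)) *
        besselIntegrand (k + l) (2 * i + (k + l) + 1) α β γ z +
      ∑ l ∈ Finset.range (c + 1), omegaCoeff (l + 1) k c * γ ^ (k + 2 * l) *
        kSeriesIntegrand (k + l + 1) (i + 1 + k + l) α β γ z := by
  rw [iinqIntegrand, nuttallQ_eq_nuttallSeries, nuttallSeries, mul_add, add_comm]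
  congr 1
  · rw [Finset.mul_sum, Finset.mul_sum]
    refine Finset.sum_congr rfl fun l _ => ?_
    rw [besselIntegrand, mul_pow, show 2 * i + (k + l) + 1 = (2 * (i + 1) + k - 1) + l by omega,
      pow_add z, show -(β ^ 2 / 2) - deltaPar α γ * z ^ 2 =
        -α * z ^ 2 + -((γ * z) ^ 2 / 2 + β ^ 2 / 2) by rw [deltaPar]; ring, Real.exp_add]
    ring_nf
  · rw [Finset.mul_sum]
    refine Finset.sum_congr rfl fun l _ => ?_
    rw [kSeriesIntegrand, mul_pow,
      show 2 * (i + 1 + k + l) - 1 = (2 * (i + 1) + k - 1) + (k + 2 * l) by omega, pow_add z]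
    push_cast
    ring

theorem integrable_iinqIntegrand (k c i : ℕ) {α : ℝ} (hα : 0 < α) (β γ : ℝ) :
    Integrable (iinqIntegrand k c (i + 1) α β γ) := by
  rw [funext (iinqIntegrand_eq_sum k c i α β γ)]
  exact (integrable_finsetSum _ fun l _ => (integrable_besselIntegrand _ _ hα β γ).const_mul _).add
    (integrable_finsetSum _ fun l _ => (integrable_kSeriesIntegrand _ _ hα β γ).const_mul _)

theorem iinq_eq_sum (k c i : ℕ) {α : ℝ} (hα : 0 < α) (β γ u : ℝ) :
    iinq k c (i + 1) α β γ u =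
      ∑ l ∈ Finset.range c, pCoeff c (l + 1) k (β ^ 2) * (γ ^ l * β ^ (k + l + 2)) *
        (∫ z in Set.Ioi u, besselIntegrand (k + l) (2 * i + (k + l) + 1) α β γ z) +
      ∑ l ∈ Finset.range (c + 1), omegaCoeff (l + 1) k c * γ ^ (k + 2 * l) *
        ∫ z in Set.Ioi u, kSeriesIntegrand (k + l + 1) (i + 1 + k + l) α β γ z := by
  have h1 : ∀ l ∈ Finset.range c, Integrable (fun z =>
      pCoeff c (l + 1) k (β ^ 2) * (γ ^ l * β ^ (k + l + 2)) *
        besselIntegrand (k + l) (2 * i + (k + l) + 1) α β γ z) (volume.restrict (Set.Ioi u)) :=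
    fun l _ => ((integrable_besselIntegrand _ _ hα β γ).const_mul _).integrableOn
  have h2 : ∀ l ∈ Finset.range (c + 1), Integrable (fun z =>
      omegaCoeff (l + 1) k c * γ ^ (k + 2 * l) *
        kSeriesIntegrand (k + l + 1) (i + 1 + k + l) α β γ z) (volume.restrict (Set.Ioi u)) :=
    fun l _ => ((integrable_kSeriesIntegrand _ _ hα β γ).const_mul _).integrableOn
  rw [iinq, funext (iinqIntegrand_eq_sum k c i α β γ),
    integral_add (integrable_finsetSum _ h1) (integrable_finsetSum _ h2),
    integral_finsetSum _ h1, integral_finsetSum _ h2]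
  simp only [integral_const_mul]

theorem iinq_eq_iinqForm (k c i : ℕ) {α : ℝ} (hα : 0 < α) (β γ : ℝ) {u : ℝ} (hu : 0 ≤ u) :
    iinq k c (i + 1) α β γ u =
      iinqForm (fun c' k' => nuttallQ (2 * c' + k' + 1) k') kIntegral k c (i + 1) α β γ u := by
  rw [iinq_eq_sum k c i hα, iinqForm, sum_Icc_one, sum_Icc_one, Finset.mul_sum]
  congr 1
  · refine Finset.sum_congr rfl fun l _ => ?_
    rw [integral_besselIntegrand _ _ hα, Nat.add_sub_cancel,
      show k + (l + 1) - 1 = k + l by omega, Nat.add_sub_cancel, ← add_assoc k l 1,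
      show k + l + 1 + 1 = k + l + 2 by ring]
    ring
  · refine Finset.sum_congr rfl fun l _ => ?_
    rw [Nat.add_sub_cancel, show i + 1 + k + (l + 1) - 1 = i + 1 + k + l by omega,
      ← add_assoc k l 1]
    -- Otherwise the coefficient contains a positive power of `γ = 0`.
    by_cases h : γ ≠ 0 ∨ k + l + 1 = 1
    · rw [kIntegral_eq (by omega) _ _ _ hu h]
    · push Not at h
      rw [h.1, zero_pow (by omega)]
      ring

/-! ### Closed form and continuity -/

theorem kForm_phi3Closed {m n : ℕ} {α β γ u : ℝ} (hα : 0 < α)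
    (hβ : β ≠ 0) (hγ : γ ≠ 0) (hu : 0 < u) :
    kForm phi3Closed m n α β γ u = kForm (fun b c => phi3Reg b c) m n α β γ u := by
  have hδ := deltaPar_pos hα γ
  have hθ : 0 < thetaPar α γ := by
    unfold thetaPar
    positivity
  have hz : 0 < deltaPar α γ * thetaPar α γ * u ^ 2 * β ^ 2 / 2 := by positivity
  unfold kForm iForm
  congr 1
  refine Finset.sum_congr rfl fun k _ => ?_
  rw [← phi3Reg_eq_phi3Closed 1 _ _ _ le_rfl (by positivity) (Or.inl hz)]
  congr 2
  refine Finset.sum_congr rfl fun l hl => ?_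
  rw [← phi3Reg_eq_phi3Closed l _ _ _ (Finset.mem_Icc.1 hl).1 (by positivity) (Or.inl hz)]

theorem iinq_eq_iinqClosed (k c i : ℕ) {α β γ u : ℝ} (hα : 0 < α) (hβ : β ≠ 0) (hγ : γ ≠ 0)
    (hu : 0 < u) : iinq k c (i + 1) α β γ u = iinqClosed k c (i + 1) α β γ u := by
  rw [iinq_eq_iinqForm k c i hα β γ hu.le, iinqClosed]
  unfold iinqForm
  simp only [nuttallQ_eq_nuttallClosed]
  congr 1
  refine Finset.sum_congr rfl fun l hl => ?_
  have := (Finset.mem_Icc.1 hl).1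
  rw [kIntegral_eq_kForm (by omega) (by omega) hα hβ hγ hu.le, kForm_phi3Closed hα hβ hγ hu]

/-- An integral over `(u, ∞)` depends continuously on `u` and on the parameters of its integrand,
if the integrand is continuous and dominated. -/
theorem continuous_setIntegral_Ioi {F : ℝ × ℝ × ℝ → ℝ → ℝ} {g : ℝ → ℝ}
    (hF : Continuous fun p : (ℝ × ℝ × ℝ) × ℝ => F p.1 p.2) (hg : Integrable g)
    (hle : ∀ p z, |F p z| ≤ g z) :
    Continuous fun p : ℝ × ℝ × ℝ => ∫ z in Set.Ioi p.2.2, F p z := by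
  have h1 : ∀ p : ℝ × ℝ × ℝ, ∫ z in Set.Ioi p.2.2, F p z =
      ∫ z, (Set.Ioi p.2.2).indicator (F p) z := fun p =>
    (integral_indicator measurableSet_Ioi).symm
  simp only [h1]
  rw [continuous_iff_continuousAt]
  intro p₀
  have hFp : ∀ p, Continuous (F p) := fun p => hF.comp (f := fun z : ℝ => (p, z)) (by fun_prop)
  have hFz : ∀ z, Continuous fun p => F p z := fun z =>
    hF.comp (f := fun p : ℝ × ℝ × ℝ => (p, z)) (by fun_prop)
  refine continuousAt_of_dominated (bound := g)
    (.of_forall fun p => (hFp p).aestronglyMeasurable.indicator measurableSet_Ioi)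
    (.of_forall fun p => ae_of_all _ fun z => ?_) hg ?_
  · rw [Real.norm_eq_abs]
    by_cases hz : z ∈ Set.Ioi p.2.2
    · rw [Set.indicator_of_mem hz]
      exact hle p z
    · rw [Set.indicator_of_notMem hz, abs_zero]
      exact (abs_nonneg _).trans (hle p z)
  · have hne : ∀ᵐ z : ℝ, z ≠ p₀.2.2 := by
      simp [ae_iff, measure_singleton]
    filter_upwards [hne] with z hz
    have hu : Continuous fun p : ℝ × ℝ × ℝ => p.2.2 := by fun_prop
    rcases lt_or_gt_of_ne hz with h | h
    · refine (continuousAt_const (y := (0 : ℝ))).congr ?_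
      filter_upwards [(isOpen_lt continuous_const hu).mem_nhds h] with p hp
      rw [Set.indicator_of_notMem]
      exact not_lt.2 (le_of_lt hp)
    · refine (hFz z).continuousAt.congr ?_
      filter_upwards [(isOpen_lt hu continuous_const).mem_nhds h] with p hp
      rw [Set.indicator_of_mem]
      exact hp

/-- The factors `γ^l` and `β^l` are outside of the integrals, so that the integrands are dominated
uniformly in `β` and `γ`. -/
theorem continuous_iinq (k c i : ℕ) {α : ℝ} (hα : 0 < α) :
    Continuous fun p : ℝ × ℝ × ℝ => iinq k c (i + 1) α p.1 p.2.1 p.2.2 := by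
  simp only [iinq_eq_sum k c i hα]
  refine Continuous.add (continuous_finsetSum _ fun l _ => ?_)
    (continuous_finsetSum _ fun l _ => ?_)
  · refine Continuous.mul ?_ (continuous_setIntegral_Ioi (continuous_besselIntegrand _ _ _)
      (integrable_pow_mul_gaussian hα _).abs fun p z => abs_besselIntegrand_le _ _ _ _ _ _)
    unfold pCoeff
    fun_prop
  · exact Continuous.mul (by fun_prop) (continuous_setIntegral_Ioi
      (continuous_kSeriesIntegrand _ _ _)
      (integrable_pow_mul_gaussian hα _).abs fun p z => abs_kSeriesIntegrand_le _ _ _ _ _ _)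

end

theorem theorem3 :
    -- the incomplete integral converges and reduces to Nuttall Q-functions and `K`-integrals
    (∀ (k c j : ℕ) (α β γ u : ℝ), 1 ≤ j → 0 < α → 0 ≤ u →
      IntegrableOn (iinqIntegrand k c j α β γ) (Set.Ioi u) ∧
      iinq k c j α β γ u =
        iinqForm (fun c' k' => nuttallQ (2 * c' + k' + 1) k') kIntegral k c j α β γ u) ∧
    -- the `K`-integral in terms of the regularized `Φ₃`
    (∀ (m n : ℕ) (α β γ u : ℝ), 1 ≤ m → 1 ≤ n → 0 < α → β ≠ 0 → γ ≠ 0 → 0 ≤ u →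
      IntegrableOn (kIntegrand m n α β γ) (Set.Ioi u) ∧
      kIntegral m n α β γ u = kForm (fun b c => phi3Reg b c) m n α β γ u) ∧
    -- the regularized `Φ₃` as a finite combination of Marcum Q-functions
    (∀ (b : ℕ) (c : ℤ) (w z : ℝ), 1 ≤ b → 0 < w → (0 < z ∨ (b = 1 ∧ z = 0)) →
      phi3Reg b c w z = phi3Closed b c w z) ∧
    -- the Nuttall Q-functions in terms of Marcum Q-functions and modified Bessel functions
    (∀ (c k : ℕ) (a b : ℝ), nuttallQ (2 * c + k + 1) k a b = nuttallClosed c k a b) ∧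
    -- the resulting closed form
    (∀ (k c j : ℕ) (α β γ u : ℝ), 1 ≤ j → 0 < α → β ≠ 0 → γ ≠ 0 → 0 < u →
      iinq k c j α β γ u = iinqClosed k c j α β γ u) ∧
    -- for `β = 0`, `γ = 0` or `u = 0` the closed form is read as a limit
    (∀ (k c j : ℕ) (α β γ u : ℝ), 1 ≤ j → 0 < α → 0 ≤ u →
      Tendsto (fun p : ℝ × ℝ × ℝ => iinqClosed k c j α p.1 p.2.1 p.2.2)
        (𝓝[{p : ℝ × ℝ × ℝ | p.1 ≠ 0 ∧ p.2.1 ≠ 0 ∧ 0 < p.2.2}] (β, γ, u))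
        (𝓝 (iinq k c j α β γ u))) := by
  refine ⟨fun k c j α β γ u hj hα hu => ?_, fun m n α β γ u hm hn hα hβ hγ hu =>
    ⟨integrableOn_kIntegrand hm n hα β hu (Or.inl hγ), kIntegral_eq_kForm hm hn hα hβ hγ hu⟩,
    phi3Reg_eq_phi3Closed, nuttallQ_eq_nuttallClosed,
    fun k c j α β γ u hj hα hβ hγ hu => ?_, fun k c j α β γ u hj hα _ => ?_⟩
  · obtain ⟨i, rfl⟩ := Nat.exists_eq_add_of_le' hj
    exact ⟨(integrable_iinqIntegrand k c i hα β γ).integrableOn, iinq_eq_iinqForm k c i hα β γ hu⟩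
  · obtain ⟨i, rfl⟩ := Nat.exists_eq_add_of_le' hj
    exact iinq_eq_iinqClosed k c i hα hβ hγ hu
  · obtain ⟨i, rfl⟩ := Nat.exists_eq_add_of_le' hj
    refine Tendsto.congr' ?_ (((continuous_iinq k c i hα).tendsto (β, γ, u)).mono_left
      nhdsWithin_le_nhds)
    filter_upwards [self_mem_nhdsWithin] with p hp
    exact iinq_eq_iinqClosed k c i hα hp.1 hp.2.1 hp.2.2
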